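/- Let $n_1,n_2,s,\tilde m\ge 1$ and $r\ge 0$ be integers, let $\mu_0>0$ be real, let $n=n_1+n_2-1$, let $c_{\mathrm s}=\max\{n/n_1,n/n_2\}$, and number indices from $0$. **Operators.** For $X\in\mathbb C^{s\times n}$ let $[\mathcal H(X)](i,j,k)=X(k,i+j)$, a tensor in $\mathbb C^{n_1\times n_2\times s}$. Let $w_a$ be the number of pairs $(i,j)$ with $0\le i<n_1$, $0\le j<n_2$ and $i+j=a$, let $\mathcal D$ multiply the $a$-th column of an $s\times n$ matrix by $\sqrt{w_a}$, let $\mathcal G=\mathcal H\mathcal D^{-1}$, and let $\mathcal G^*$ be its adjoint. Let $\mathcal M_1,\mathcal M_2,\mathcal M_3$ be the three matricizations of a tensor, $\|\cdot\|$ the spectral norm of a matrix, $\|\cdot\|_{2,\infty}$ the largest $\ell_2$-norm of a row, and $\sigma_{\max}(\mathcal Z)=\max_{k=1,2,3}\|\mathcal M_k(\mathcal Z)\|$. **Incoherence.** A tensor $\mathcal Z_\star\in\mathbb C^{n_1\times n_2\times s}$ is called $\mu_0$-incoherent (with rank $r$) if $\mathcal Z_\star=\mathcal H(X_\star)$ for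 some $X_\star\in\mathbb C^{s\times n}$, all three matricizations of $\mathcal Z_\star$ have rank $r$, and $\mathcal Z_\star=\mathcal S_\star\times_1 L_\star\times_2 R_\star\times_3 V_\star$ with $\mathcal S_\star\in\mathbb C^{r\times r\times r}$ and $L_\star\in\mathbb C^{n_1\times r}$, $R_\star\in\mathbb C^{n_2\times r}$, $V_\star\in\mathbb C^{s\times r}$ having orthonormal columns, where $$\|L_\star\|_{2,\infty}\le\sqrt{\mu_0c_{\mathrm s}r/n},\qquad \|R_\star\|_{2,\infty}\le\sqrt{\mu_0c_{\mathrm s}r/n}.$$ **Sampling.** Let $\tilde\Omega=((k_t,a_t))_{t=1}^{\tilde m}$ consist of $\tilde m$ independent samples drawn uniformly, with replacement, from $\{0,\dots,s-1\}\times\{0,\dots,n-1\}$. Let $\mathcal P_{\tilde\Omega}(M)=\sum_{t=1}^{\tilde m}M(k_t,a_t)\,e_{k_t}e_{a_t}^{T}$, so that repeated samples are counted with multiplicity, and let $\tilde p=\tilde m/(sn)$. **Lemma.** There is an absolute constant $C>0$ such that, for all $n_1,n_2,s,r,\tilde m,\mu_0$ and every $\mu_0$-incoherent $\mathcal Z_\star$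 as above, if $\tilde m\ge\mu_0c_{\mathrm s}sr\log(sn)$, then with probability at least $1-(sn)^{-2}$ the bound $$\big\|\mathcal M_i\big((\tilde p^{-1}\mathcal G\mathcal P_{\tilde\Omega}\mathcal G^*-\mathcal I)(\mathcal Z_\star)\big)\big\|\le C\sqrt{\frac{\mu_0c_{\mathrm s}sr\log(sn)}{\tilde m}}\;\sigma_{\max}(\mathcal Z_\star)$$ holds for both $i=1$ and $i=2$. -/

import Mathlib

open scoped BigOperators

noncomputable section

namespace HankelTensor

/-- Tensors of size `n₁ × n₂ × s` with complex entries; indices start at zero. -/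
abbrev Tensor3 (n₁ n₂ s : ℕ) : Type := Fin n₁ → Fin n₂ → Fin s → ℂ

/-! Matricizations. The paired column index `(i₃, i₂)` stands for the column number `i₂ + i₃ n₂`,
and likewise `(i₃, i₁)` for `i₁ + i₃ n₁` and `(i₂, i₁)` for `i₁ + i₂ n₁`. -/

/-- Mode-1 matricization. -/
def mat1 {n₁ n₂ s : ℕ} (Z : Tensor3 n₁ n₂ s) : Matrix (Fin n₁) (Fin s × Fin n₂) ℂ :=
  Matrix.of fun i₁ c => Z i₁ c.2 c.1

/-- Mode-2 matricization. -/
def mat2 {n₁ n₂ s : ℕ} (Z : Tensor3 n₁ n₂ s) : Matrix (Fin n₂) (Fin s × Fin n₁) ℂ :=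
  Matrix.of fun i₂ c => Z c.2 i₂ c.1

/-- Mode-3 matricization. -/
def mat3 {n₁ n₂ s : ℕ} (Z : Tensor3 n₁ n₂ s) : Matrix (Fin s) (Fin n₂ × Fin n₁) ℂ :=
  Matrix.of fun i₃ c => Z c.2 c.1 i₃

open scoped Matrix.Norms.L2Operator in
/-- The spectral norm (largest singular value) of a complex matrix: its operator norm with respect
to the Euclidean norms. -/
def specNorm {m n : Type*} [Fintype m] [Fintype n] [DecidableEq n] (A : Matrix m n ℂ) : ℝ := ‖A‖

/-- The largest `ℓ²`-norm of the rows of a matrix. -/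
def rowNorm {m n : Type*} [Fintype n] (A : Matrix m n ℂ) : ℝ :=
  ⨆ i : m, ‖(WithLp.toLp 2 (A i) : EuclideanSpace ℂ n)‖

/-- `σ_max` of a tensor: the largest of the spectral norms of its three matricizations. -/
def sigmaMax {n₁ n₂ s : ℕ} (Z : Tensor3 n₁ n₂ s) : ℝ :=
  max (specNorm (mat1 Z)) (max (specNorm (mat2 Z)) (specNorm (mat3 Z)))

/-- The multilinear rank. -/
def mulRank {n₁ n₂ s : ℕ} (Z : Tensor3 n₁ n₂ s) : ℕ × ℕ × ℕ :=
  ((mat1 Z).rank, (mat2 Z).rank, (mat3 Z).rank)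

/-- Mode-1 product of a tensor and a matrix. -/
def modeProd1 {n₁ n₂ s k : ℕ} (Z : Tensor3 n₁ n₂ s) (M : Matrix (Fin k) (Fin n₁) ℂ) :
    Tensor3 k n₂ s :=
  fun j i₂ i₃ => ∑ i₁, Z i₁ i₂ i₃ * M j i₁

/-- Mode-2 product of a tensor and a matrix. -/
def modeProd2 {n₁ n₂ s k : ℕ} (Z : Tensor3 n₁ n₂ s) (M : Matrix (Fin k) (Fin n₂) ℂ) :
    Tensor3 n₁ k s :=
  fun i₁ j i₃ => ∑ i₂, Z i₁ i₂ i₃ * M j i₂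

/-- Mode-3 product of a tensor and a matrix. -/
def modeProd3 {n₁ n₂ s k : ℕ} (Z : Tensor3 n₁ n₂ s) (M : Matrix (Fin k) (Fin s) ℂ) :
    Tensor3 n₁ n₂ k :=
  fun i₁ i₂ j => ∑ i₃, Z i₁ i₂ i₃ * M j i₃

/-- The tensor `(L, R, V) · S = S ×₁ L ×₂ R ×₃ V`. -/
def tucker {n₁ n₂ s r₁ r₂ r₃ : ℕ} (L : Matrix (Fin n₁) (Fin r₁) ℂ) (R : Matrix (Fin n₂) (Fin r₂) ℂ)
    (V : Matrix (Fin s) (Fin r₃) ℂ) (S : Tensor3 r₁ r₂ r₃) : Tensor3 n₁ n₂ s :=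
  modeProd3 (modeProd2 (modeProd1 S L) R) V

/-- The index `i + j` of the skew-diagonal through `(i, j)`, an element of `[n]`,
`n = n₁ + n₂ - 1`. -/
def skewIdx {n₁ n₂ : ℕ} (i : Fin n₁) (j : Fin n₂) : Fin (n₁ + n₂ - 1) :=
  ⟨i.val + j.val, by omega⟩

/-- `w_a`: the number of entries on the `a`-th skew-diagonal of an `n₁ × n₂` matrix. -/
def skewLen (n₁ n₂ : ℕ) (a : Fin (n₁ + n₂ - 1)) : ℕ :=
  (Finset.univ.filter fun q : Fin n₁ × Fin n₂ => skewIdx q.1 q.2 = a).card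

/-- The Hankel lifting operator, `[H X](i, j, k) = X(k, i + j)`. -/
def hankel {n₁ n₂ s : ℕ} (X : Matrix (Fin s) (Fin (n₁ + n₂ - 1)) ℂ) : Tensor3 n₁ n₂ s :=
  fun i j k => X k (skewIdx i j)

/-- The inverse of the reweighting operator that multiplies the `a`-th column by `√w_a`. -/
def unweight (n₁ n₂ : ℕ) {s : ℕ} (M : Matrix (Fin s) (Fin (n₁ + n₂ - 1)) ℂ) :
    Matrix (Fin s) (Fin (n₁ + n₂ - 1)) ℂ :=
  Matrix.of fun k a => ((Real.sqrt (skewLen n₁ n₂ a))⁻¹ : ℂ) * M k a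

/-- The normalized lifting operator `G = H D⁻¹`. -/
def lift {n₁ n₂ s : ℕ} (M : Matrix (Fin s) (Fin (n₁ + n₂ - 1)) ℂ) : Tensor3 n₁ n₂ s :=
  hankel (unweight n₁ n₂ M)

/-- The adjoint `G*` of the normalized lifting operator (see `lift_adjoint`): it sums a tensor along
each skew-diagonal and divides by `√w_a`. -/
def liftAdj {n₁ n₂ s : ℕ} (Z : Tensor3 n₁ n₂ s) : Matrix (Fin s) (Fin (n₁ + n₂ - 1)) ℂ :=
  Matrix.of fun k a => ((Real.sqrt (skewLen n₁ n₂ a))⁻¹ : ℂ) *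
    ∑ i, ∑ j, if skewIdx i j = a then Z i j k else 0

/-- `⟨G M, Z⟩ = ⟨M, G* Z⟩` for the entrywise complex inner products. -/
theorem lift_adjoint {n₁ n₂ s : ℕ} (M : Matrix (Fin s) (Fin (n₁ + n₂ - 1)) ℂ)
    (Z : Tensor3 n₁ n₂ s) :
    ∑ i, ∑ j, ∑ k, star (lift M i j k) * Z i j k = ∑ k, ∑ a, star (M k a) * liftAdj Z k a := by
  have h : ∀ k : Fin s, ∑ a, star (M k a) * liftAdj Z k a
      = ∑ i, ∑ j, star (lift M i j k) * Z i j k := by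
    intro k
    simp only [liftAdj, Matrix.of_apply, Finset.mul_sum]
    rw [Finset.sum_comm]
    refine Finset.sum_congr rfl fun i _ => ?_
    rw [Finset.sum_comm]
    refine Finset.sum_congr rfl fun j _ => ?_
    simp only [mul_ite, mul_zero]
    rw [Finset.sum_ite_eq]
    simp [lift, hankel, unweight]
    ring
  rw [Finset.sum_congr rfl fun k _ => h k, Finset.sum_comm]
  conv_rhs => rw [Finset.sum_comm]
  rw [Finset.sum_comm]
  refine Finset.sum_congr rfl fun i _ => ?_
  rw [Finset.sum_comm]

/-- The sampling operator of `m` samples `(k_t, a_t)` drawn with replacement,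
`M ↦ ∑ₜ M(k_t, a_t) e_{k_t} e_{a_t}ᵀ`; repeated samples count with multiplicity. -/
def sampling {s n m : ℕ} (ω : Fin m → Fin s × Fin n) (M : Matrix (Fin s) (Fin n) ℂ) :
    Matrix (Fin s) (Fin n) ℂ :=
  ∑ t, Matrix.single (ω t).1 (ω t).2 (M (ω t).1 (ω t).2)

/-- The error `(p⁻¹ G P_Ω G* - I)(Z)` with `p = m / (s n)`, `n = n₁ + n₂ - 1`. -/
def samplingError {n₁ n₂ s m : ℕ} (ω : Fin m → Fin s × Fin (n₁ + n₂ - 1))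
    (Z : Tensor3 n₁ n₂ s) : Tensor3 n₁ n₂ s :=
  (((m : ℂ) / ((s : ℂ) * ((n₁ + n₂ - 1 : ℕ) : ℂ)))⁻¹) • lift (sampling ω (liftAdj Z)) - Z

/-- `c_s = max {n / n₁, n / n₂}`, `n = n₁ + n₂ - 1`. -/
def symConst (n₁ n₂ : ℕ) : ℝ :=
  max (((n₁ + n₂ - 1 : ℕ) : ℝ) / n₁) (((n₁ + n₂ - 1 : ℕ) : ℝ) / n₂)

/-- `μ₀`-incoherence of a Hankel tensor of multilinear rank `(r, r, r)`. The row norms of `L` and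
`R` are the same for all decompositions with orthonormal factors. -/
def IsIncoherent {n₁ n₂ s : ℕ} (μ₀ : ℝ) (r : ℕ) (Z : Tensor3 n₁ n₂ s) : Prop :=
  (∃ X : Matrix (Fin s) (Fin (n₁ + n₂ - 1)) ℂ, Z = hankel X) ∧
  mulRank Z = (r, r, r) ∧
  ∃ (L : Matrix (Fin n₁) (Fin r) ℂ) (R : Matrix (Fin n₂) (Fin r) ℂ)
    (V : Matrix (Fin s) (Fin r) ℂ) (S : Tensor3 r r r),
    L.conjTranspose * L = 1 ∧ R.conjTranspose * R = 1 ∧ V.conjTranspose * V = 1 ∧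
    Z = tucker L R V S ∧
    rowNorm L ≤ Real.sqrt (μ₀ * symConst n₁ n₂ * r / ((n₁ + n₂ - 1 : ℕ) : ℝ)) ∧
    rowNorm R ≤ Real.sqrt (μ₀ * symConst n₁ n₂ * r / ((n₁ + n₂ - 1 : ℕ) : ℝ))

end HankelTensor

end

/-! On a Hankel tensor the weights in `lift` and `liftAdj` cancel, so each sample `(k, a)` keeps
exactly the entries of `Z` in slice `k` on skew-diagonal `a`. Colour the entry `(i, j, k)` by `(k, i
+ j)`. Each matricization of the error is then a rescaled, centred sum of i.i.d. colour parts of the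
matricized `Z`. In modes 1 and 2 a colour meets every row and every column at most once, so the
Hermitian dilation of a colour part has a diagonal square (`dilation_mul_self`).

Such sums are controlled by a trace moment method with exchangeable pairs. Resampling one term and
applying a mean value inequality for odd powers (`trace_sub_mul_pow_sub_pow_le`, `exchange_bound`)
bounds the moment of order `2q + 2` by the moment of order `2q` weighted by the diagonal squares.
Young's inequality on each diagonal entry absorbs the former (`sum_trace_centredSum_pow_le`). What
remains are moments of scalar sums of bounded nonnegative variables (`sum_moment_le`). Markov's
inequality with `q + 1 = ⌈log N⌉`, where `N = s n`, gives `card_colour_sampling_le`.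

Incoherence supplies the scalar bounds (`IsIncoherent.bounds`): rows and columns of both
matricizations have squared norm at most `β² σ²`, and entries have modulus at most `β² σ`, where `σ
= sigmaMax Z`. Probabilities are counts of sample sequences divided by `N ^ m`, and a union bound
joins the two modes. -/

namespace HankelTensor

open Matrix

/-! ### Trace inequalities for Hermitian matrices -/

section Trace

variable {ι : Type*} [Fintype ι] [DecidableEq ι]

/-- Powers of a Hermitian matrix in an orthonormal eigenbasis. -/
theorem exists_spectral_pow {S : Matrix ι ι ℂ} (hS : S.IsHermitian) :
    ∃ (U : Matrix ι ι ℂ) (d : ι → ℝ), U * Uᴴ = 1 ∧ Uᴴ * U = 1 ∧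
      ∀ k : ℕ, S ^ k = U * diagonal (fun i => ((d i ^ k : ℝ) : ℂ)) * Uᴴ := by
  have h1 : (hS.eigenvectorUnitary : Matrix ι ι ℂ) * (hS.eigenvectorUnitary : Matrix ι ι ℂ)ᴴ = 1 :=
    Unitary.mul_star_self_of_mem hS.eigenvectorUnitary.2
  have h2 : (hS.eigenvectorUnitary : Matrix ι ι ℂ)ᴴ * (hS.eigenvectorUnitary : Matrix ι ι ℂ) = 1 :=
    Unitary.star_mul_self_of_mem hS.eigenvectorUnitary.2
  refine ⟨hS.eigenvectorUnitary, hS.eigenvalues, h1, h2, fun k => ?_⟩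
  have h0 : S = (hS.eigenvectorUnitary : Matrix ι ι ℂ) *
      diagonal (fun i => ((hS.eigenvalues i : ℝ) : ℂ)) *
      (hS.eigenvectorUnitary : Matrix ι ι ℂ)ᴴ := by
    conv_lhs => rw [hS.spectral_theorem, Unitary.conjStarAlgAut_apply]
    rfl
  generalize (hS.eigenvectorUnitary : Matrix ι ι ℂ) = U at *
  generalize hS.eigenvalues = d at *
  induction k with
  | zero => simp [h1]
  | succ k ih =>
    rw [pow_succ, ih]
    conv_lhs => rw [h0]
    calc _ = U * diagonal (fun i => ((d i ^ k : ℝ) : ℂ)) * (Uᴴ * U) *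
          diagonal (fun i => ((d i : ℝ) : ℂ)) * Uᴴ := by simp only [Matrix.mul_assoc]
      _ = U * (diagonal (fun i => ((d i ^ k : ℝ) : ℂ)) *
          diagonal (fun i => ((d i : ℝ) : ℂ))) * Uᴴ := by rw [h2, Matrix.mul_one, Matrix.mul_assoc U]
      _ = _ := by simp [diagonal_mul_diagonal, pow_succ]

/-- The trace of `Sᵃ Tᵇ` in terms of the eigenvalues and the overlaps of the eigenvectors. -/
theorem exists_trace_pow_mul_pow {S T : Matrix ι ι ℂ} (hS : S.IsHermitian) (hT : T.IsHermitian) :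
    ∃ (x y : ι → ℝ) (q : ι → ι → ℝ), (∀ i j, 0 ≤ q i j) ∧
      ∀ a b : ℕ, (trace (S ^ a * T ^ b)).re = ∑ i, ∑ j, q i j * (x i ^ a * y j ^ b) := by
  obtain ⟨U, x, -, -, hU⟩ := exists_spectral_pow hS
  obtain ⟨V, y, -, -, hV⟩ := exists_spectral_pow hT
  refine ⟨x, y, fun i j => Complex.normSq ((Uᴴ * V) i j), fun i j => Complex.normSq_nonneg _,
    fun a b => ?_⟩
  rw [hU, hV]
  have h : trace (U * diagonal (fun i => ((x i ^ a : ℝ) : ℂ)) * Uᴴ *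
      (V * diagonal (fun i => ((y i ^ b : ℝ) : ℂ)) * Vᴴ)) =
      trace (diagonal (fun i => ((x i ^ a : ℝ) : ℂ)) * (Uᴴ * V) *
        (diagonal (fun i => ((y i ^ b : ℝ) : ℂ)) * (Uᴴ * V)ᴴ)) := by
    rw [conjTranspose_mul, conjTranspose_conjTranspose]
    rw [show U * diagonal (fun i => ((x i ^ a : ℝ) : ℂ)) * Uᴴ *
      (V * diagonal (fun i => ((y i ^ b : ℝ) : ℂ)) * Vᴴ) = U *
        (diagonal (fun i => ((x i ^ a : ℝ) : ℂ)) * (Uᴴ * V) *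
        (diagonal (fun i => ((y i ^ b : ℝ) : ℂ)) * Vᴴ)) by simp only [Matrix.mul_assoc],
      trace_mul_comm]
    simp only [Matrix.mul_assoc]
  rw [h]
  simp only [trace, diag_apply]
  rw [Complex.re_sum]
  refine Finset.sum_congr rfl fun i _ => ?_
  rw [Matrix.mul_apply, Complex.re_sum]
  refine Finset.sum_congr rfl fun j _ => ?_
  rw [diagonal_mul, diagonal_mul, conjTranspose_apply]
  have : ∀ z : ℂ, (x i ^ a : ℝ) * z * (((y j ^ b : ℝ) : ℂ) * star z) =
      ((Complex.normSq z * (x i ^ a * y j ^ b) : ℝ) : ℂ) := by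
    intro z
    push_cast
    rw [Complex.normSq_eq_conj_mul_self, Complex.star_def]
    ring
  rw [this, Complex.ofReal_re]

/-- Factor the difference of powers as a geometric sum of `2q + 1` monomials of degree `2q`; each is
at most the larger of the two even powers, hence at most their sum. -/
theorem sub_mul_pow_sub_pow_le (x y : ℝ) (q : ℕ) :
    (x - y) * (x ^ (2 * q + 1) - y ^ (2 * q + 1)) ≤
      (2 * q + 1) * ((x - y) ^ 2 * (x ^ (2 * q) + y ^ (2 * q))) := by
  have hs : ∑ i ∈ Finset.range (2 * q + 1), x ^ i * y ^ (2 * q + 1 - 1 - i) ≤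
      (2 * q + 1) * (x ^ (2 * q) + y ^ (2 * q)) := by
    have : ∀ i ∈ Finset.range (2 * q + 1), x ^ i * y ^ (2 * q + 1 - 1 - i) ≤
        x ^ (2 * q) + y ^ (2 * q) := by
      intro i hi
      have hi' : i + (2 * q + 1 - 1 - i) = 2 * q := by
        have := Finset.mem_range.1 hi
        omega
      have hx : 0 ≤ |x| ^ (2 * q) := by positivity
      have hy : 0 ≤ |y| ^ (2 * q) := by positivity
      have ex : x ^ (2 * q) = |x| ^ (2 * q) := by rw [pow_mul, pow_mul, sq_abs]
      have ey : y ^ (2 * q) = |y| ^ (2 * q) := by rw [pow_mul, pow_mul, sq_abs]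
      rw [ex, ey]
      refine (le_abs_self _).trans ?_
      rw [abs_mul, abs_pow, abs_pow]
      rcases le_total |x| |y| with h | h
      · calc |x| ^ i * |y| ^ (2 * q + 1 - 1 - i) ≤ |y| ^ i * |y| ^ (2 * q + 1 - 1 - i) := by gcongr
          _ = |y| ^ (2 * q) := by rw [← pow_add, hi']
          _ ≤ _ := by linarith
      · calc |x| ^ i * |y| ^ (2 * q + 1 - 1 - i) ≤ |x| ^ i * |x| ^ (2 * q + 1 - 1 - i) := by gcongr
          _ = |x| ^ (2 * q) := by rw [← pow_add, hi']
          _ ≤ _ := by linarith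
    refine (Finset.sum_le_sum this).trans (le_of_eq ?_)
    simp [mul_add]
  rw [← (Commute.all x y).mul_geom_sum₂]
  calc _ = (x - y) ^ 2 * ∑ i ∈ Finset.range (2 * q + 1), x ^ i * y ^ (2 * q + 1 - 1 - i) := by ring
    _ ≤ (x - y) ^ 2 * ((2 * q + 1) * (x ^ (2 * q) + y ^ (2 * q))) := by gcongr
    _ = _ := by ring

/-- A mean value inequality for the trace of odd powers. -/
theorem trace_sub_mul_pow_sub_pow_le {S T : Matrix ι ι ℂ} (hS : S.IsHermitian)
    (hT : T.IsHermitian) (q : ℕ) :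
    (trace ((S - T) * (S ^ (2 * q + 1) - T ^ (2 * q + 1)))).re ≤
      (2 * q + 1) * ((trace ((S - T) ^ 2 * S ^ (2 * q))).re +
        (trace ((S - T) ^ 2 * T ^ (2 * q))).re) := by
  obtain ⟨x, y, w, hw, h⟩ := exists_trace_pow_mul_pow hS hT
  have e1 : trace ((S - T) * (S ^ (2 * q + 1) - T ^ (2 * q + 1))) =
      trace (S ^ (2 * q + 2) * T ^ 0) - trace (S ^ 1 * T ^ (2 * q + 1)) -
      trace (S ^ (2 * q + 1) * T ^ 1) + trace (S ^ 0 * T ^ (2 * q + 2)) := by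
    rw [sub_mul, mul_sub, mul_sub, trace_sub, trace_sub, trace_sub,
      trace_mul_comm T (S ^ (2 * q + 1)), ← pow_succ', ← pow_succ']
    simp only [pow_zero, pow_one, mul_one, one_mul]
    ring
  have e2 : trace ((S - T) ^ 2 * S ^ (2 * q)) = trace (S ^ (2 * q + 2) * T ^ 0) -
      2 * trace (S ^ (2 * q + 1) * T ^ 1) + trace (S ^ (2 * q) * T ^ 2) := by
    have t1 : trace (S * T * S ^ (2 * q)) = trace (S ^ (2 * q + 1) * T) := by
      rw [trace_mul_comm, ← mul_assoc, ← pow_succ]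
    have t2 : trace (T * S * S ^ (2 * q)) = trace (S ^ (2 * q + 1) * T) := by
      rw [mul_assoc, trace_mul_comm, ← pow_succ']
    rw [sq, sub_mul, mul_sub, mul_sub, sub_mul, sub_mul, sub_mul, trace_sub, trace_sub, trace_sub,
      t1, t2, ← sq, ← sq, ← pow_add, trace_mul_comm (T ^ 2), add_comm 2 (2 * q)]
    simp only [pow_zero, pow_one, mul_one]
    ring
  have e3 : trace ((S - T) ^ 2 * T ^ (2 * q)) = trace (S ^ 2 * T ^ (2 * q)) -
      2 * trace (S ^ 1 * T ^ (2 * q + 1)) + trace (S ^ 0 * T ^ (2 * q + 2)) := by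
    have t1 : trace (S * T * T ^ (2 * q)) = trace (S * T ^ (2 * q + 1)) := by
      rw [mul_assoc, ← pow_succ']
    have t2 : trace (T * S * T ^ (2 * q)) = trace (S * T ^ (2 * q + 1)) := by
      rw [trace_mul_comm, ← mul_assoc, ← pow_succ, trace_mul_comm]
    rw [sq, sub_mul, mul_sub, mul_sub, sub_mul, sub_mul, sub_mul, trace_sub, trace_sub, trace_sub,
      t1, t2, ← sq, ← sq, ← pow_add, add_comm 2 (2 * q)]
    simp only [pow_zero, pow_one, one_mul]
    ring
  rw [e1, e2, e3]
  simp only [Complex.add_re, Complex.sub_re, Complex.mul_re, Complex.re_ofNat, Complex.im_ofNat,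
    zero_mul, sub_zero, h, Finset.mul_sum, ← Finset.sum_sub_distrib, ← Finset.sum_add_distrib]
  -- All traces are sums over pairs of eigenvalues with the same nonnegative weights, so the scalar
  -- inequality applies term by term.
  refine Finset.sum_le_sum fun i _ => Finset.sum_le_sum fun j _ => ?_
  calc _ = w i j * ((x i - y j) * (x i ^ (2 * q + 1) - y j ^ (2 * q + 1))) := by ring
    _ ≤ w i j * ((2 * q + 1) * ((x i - y j) ^ 2 * (x i ^ (2 * q) + y j ^ (2 * q)))) :=
      mul_le_mul_of_nonneg_left (sub_mul_pow_sub_pow_le _ _ _) (hw i j)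
    _ = _ := by ring

/-- A Young-type inequality by comparing `2w` with `x²`: the larger of the two decides which summand
dominates. The factor `1/2` on the high power is what later allows absorption. -/
theorem mul_pow_le_half (w x : ℝ) (hw : 0 ≤ w) (q : ℕ) :
    w * x ^ (2 * q) ≤ x ^ (2 * q + 2) / 2 + (2 * w) ^ (q + 1) / 2 := by
  have hx : 0 ≤ x ^ (2 * q) := by rw [pow_mul]; positivity
  have hx2 : 0 ≤ x ^ (2 * q + 2) := by rw [show 2 * q + 2 = 2 * (q + 1) by ring, pow_mul]; positivity
  have hw2 : 0 ≤ (2 * w) ^ (q + 1) := by positivity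
  rcases le_total (2 * w) (x ^ 2) with h | h
  · have : 2 * w * x ^ (2 * q) ≤ x ^ 2 * x ^ (2 * q) := by gcongr
    have e : x ^ 2 * x ^ (2 * q) = x ^ (2 * q + 2) := by ring
    linarith
  · have : 2 * w * (x ^ 2) ^ q ≤ 2 * w * (2 * w) ^ q := by gcongr
    rw [← pow_mul] at this
    have e : 2 * w * (2 * w) ^ q = (2 * w) ^ (q + 1) := by ring
    linarith

/-- A diagonal entry of a power is an average of powers of eigenvalues with weights `|U i j|²`,
which sum to one, so the scalar inequality can be averaged. -/
theorem diag_pow_le {S : Matrix ι ι ℂ} (hS : S.IsHermitian) (q : ℕ) (i : ι) (w : ℝ) (hw : 0 ≤ w) :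
    w * ((S ^ (2 * q)) i i).re ≤ ((S ^ (2 * q + 2)) i i).re / 2 + (2 * w) ^ (q + 1) / 2 := by
  obtain ⟨U, d, h1, -, h⟩ := exists_spectral_pow hS
  have key : ∀ k, ((S ^ k) i i).re = ∑ j, Complex.normSq (U i j) * d j ^ k := by
    intro k
    rw [h, Matrix.mul_apply, Complex.re_sum]
    refine Finset.sum_congr rfl fun j _ => ?_
    rw [mul_diagonal, conjTranspose_apply, ← Complex.ofReal_re (_ * _)]
    congr 1
    push_cast
    rw [Complex.normSq_eq_conj_mul_self, Complex.star_def]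
    ring
  have hone : ∑ j, Complex.normSq (U i j) = 1 := by
    have := key 0
    simpa using this.symm
  calc w * ((S ^ (2 * q)) i i).re = ∑ j, Complex.normSq (U i j) * (w * d j ^ (2 * q)) := by
        rw [key, Finset.mul_sum]
        exact Finset.sum_congr rfl fun j _ => by ring
    _ ≤ ∑ j, Complex.normSq (U i j) * (d j ^ (2 * q + 2) / 2 + (2 * w) ^ (q + 1) / 2) :=
        Finset.sum_le_sum fun j _ =>
          mul_le_mul_of_nonneg_left (mul_pow_le_half _ _ hw _) (Complex.normSq_nonneg _)
    _ = _ := by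
        simp only [mul_add, Finset.sum_add_distrib, ← Finset.sum_mul, hone, one_mul, key,
          Finset.sum_div, mul_div_assoc]

open scoped Matrix.Norms.L2Operator in
theorem norm_pow_le_trace {S : Matrix ι ι ℂ} (hS : S.IsHermitian) (p : ℕ) :
    ‖S‖ ^ (2 * p + 2) ≤ (trace (S ^ (2 * p + 2))).re := by
  obtain ⟨U, d, h1, h2, h⟩ := exists_spectral_pow hS
  have hnn : ∀ i, 0 ≤ d i ^ (2 * p + 2) := fun i => by
    rw [show 2 * p + 2 = 2 * (p + 1) by ring, pow_mul]; positivity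
  have htr : (trace (S ^ (2 * p + 2))).re = ∑ i, d i ^ (2 * p + 2) := by
    rw [h, trace_mul_comm, ← mul_assoc, h2, one_mul, trace_diagonal, Complex.re_sum]
    simp only [Complex.ofReal_re]
  have hU : U ∈ unitary (Matrix ι ι ℂ) := ⟨h2, h1⟩
  have hn : ‖S‖ = ‖fun i => ((d i ^ 1 : ℝ) : ℂ)‖ := by
    rw [← l2_opNorm_diagonal]
    have h' := h 1
    rw [pow_one] at h'
    rw [h', ← Matrix.star_eq_conjTranspose,
      CStarRing.norm_mul_mem_unitary _ (Unitary.star_mem hU), CStarRing.norm_mem_unitary_mul _ hU]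
  rw [htr, hn]
  rcases isEmpty_or_nonempty ι with he | he
  · rw [Subsingleton.elim (fun i => ((d i ^ 1 : ℝ) : ℂ)) 0]
    simp
  · obtain ⟨i, hi⟩ := Finite.exists_max fun i => ‖((d i ^ 1 : ℝ) : ℂ)‖
    refine (pow_le_pow_left₀ (norm_nonneg _) ((pi_norm_le_iff_of_nonempty _).2 hi) _).trans ?_
    rw [Complex.norm_real, Real.norm_eq_abs, pow_one, show 2 * p + 2 = 2 * (p + 1) by ring,
      pow_mul, sq_abs, ← pow_mul]
    exact Finset.single_le_sum (f := fun i => d i ^ (2 * (p + 1))) (fun j _ => hnn j)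
      (Finset.mem_univ i)

theorem trace_mul_mul_self_nonneg {A S : Matrix ι ι ℂ} (hA : A.IsHermitian) (hS : S.IsHermitian)
    (q : ℕ) : 0 ≤ (trace (A ^ 2 * S ^ (2 * q))).re := by
  obtain ⟨x, y, w, hw, h⟩ := exists_trace_pow_mul_pow hA hS
  rw [h]
  refine Finset.sum_nonneg fun i _ => Finset.sum_nonneg fun j _ => ?_
  rw [pow_mul]
  have := hw i j
  positivity

/-- Parallelogram identity: the two sides differ by the trace with `(A + B) ^ 2`, which is
nonnegative. -/
theorem trace_sub_sq_mul_le {A B S : Matrix ι ι ℂ} (hA : A.IsHermitian) (hB : B.IsHermitian)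
    (hS : S.IsHermitian) (q : ℕ) :
    (trace ((A - B) ^ 2 * S ^ (2 * q))).re ≤
      2 * (trace (A * A * S ^ (2 * q))).re + 2 * (trace (B * B * S ^ (2 * q))).re := by
  have h := trace_mul_mul_self_nonneg (hA.add hB) hS q
  have e : trace ((A - B) ^ 2 * S ^ (2 * q)) = 2 * trace (A * A * S ^ (2 * q)) +
      2 * trace (B * B * S ^ (2 * q)) - trace ((A + B) ^ 2 * S ^ (2 * q)) := by
    simp only [sq, sub_mul, mul_sub, add_mul, mul_add, trace_sub, trace_add]
    ring
  rw [e]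
  simp only [Complex.add_re, Complex.sub_re, Complex.mul_re, Complex.re_ofNat, Complex.im_ofNat,
    zero_mul, sub_zero]
  linarith

end Trace

/-! ### Moments of i.i.d. sums by exchangeable pairs -/

section Moment

/-- Exchange the `t`-th sample with an additional one. -/
def exchange {α : Type*} {m : ℕ} (t : Fin m) : ((Fin m → α) × α) ≃ ((Fin m → α) × α) where
  toFun p := (Function.update p.1 t p.2, p.1 t)
  invFun p := (Function.update p.1 t p.2, p.1 t)
  left_inv p := by simp
  right_inv p := by simp

variable {ι α : Type*} [Fintype α] {m : ℕ}

/-- The sum of the centred samples. -/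
noncomputable def centredSum (Y : α → Matrix ι ι ℂ) (ω : Fin m → α) : Matrix ι ι ℂ :=
  ∑ t, (Y (ω t) - ((Fintype.card α : ℂ))⁻¹ • ∑ a, Y a)

theorem centredSum_isHermitian {Y : α → Matrix ι ι ℂ} (hY : ∀ a, (Y a).IsHermitian)
    (ω : Fin m → α) : (centredSum Y ω).IsHermitian := by
  unfold centredSum IsHermitian
  rw [conjTranspose_sum]
  refine Finset.sum_congr rfl fun t _ => ?_
  rw [conjTranspose_sub, conjTranspose_smul, conjTranspose_sum, (hY _).eq]
  simp [fun a => (hY a).eq]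

theorem centredSum_sub_update (Y : α → Matrix ι ι ℂ) (ω : Fin m → α) (t : Fin m) (a : α) :
    centredSum Y ω - centredSum Y (Function.update ω t a) = Y (ω t) - Y a := by
  unfold centredSum
  rw [← Finset.sum_sub_distrib, Finset.sum_eq_single t]
  · simp
  · intro u _ hu
    simp [Function.update_of_ne hu]
  · simp

theorem sum_centred_eq_zero [Nonempty α] (Y : α → Matrix ι ι ℂ) :
    ∑ a, (Y a - ((Fintype.card α : ℂ))⁻¹ • ∑ b, Y b) = 0 := by
  rw [Finset.sum_sub_distrib, Finset.sum_const, Finset.card_univ, ← Nat.cast_smul_eq_nsmul ℂ,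
    smul_smul, mul_inv_cancel₀ (Nat.cast_ne_zero.2 Fintype.card_ne_zero), one_smul, sub_self]

variable [Fintype ι] [DecidableEq ι]

/-- Adjoin an independent extra sample. Swapping it with sample `t` preserves the counting measure,
so the left side can be symmetrized into a product of the increment of the sum and the increment of
its odd power, where the mean value inequality applies. -/
theorem exchange_bound [Nonempty α] {Y : α → Matrix ι ι ℂ} (hY : ∀ a, (Y a).IsHermitian) (q : ℕ)
    (t : Fin m) :
    ∑ p : (Fin m → α) × α, (trace ((Y (p.1 t) - ((Fintype.card α : ℂ))⁻¹ • ∑ a, Y a) *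
        centredSum Y p.1 ^ (2 * q + 1))).re ≤
      (2 * q + 1) * ∑ p : (Fin m → α) × α,
        (trace ((Y (p.1 t) - Y p.2) ^ 2 * centredSum Y p.1 ^ (2 * q))).re := by
  set f : (Fin m → α) × α → ℝ := fun p =>
    (trace ((Y (p.1 t) - ((Fintype.card α : ℂ))⁻¹ • ∑ a, Y a) *
        centredSum Y p.1 ^ (2 * q + 1))).re with hf
  set g : (Fin m → α) × α → ℝ := fun p =>
    (trace ((Y p.2 - ((Fintype.card α : ℂ))⁻¹ • ∑ a, Y a) *
        centredSum Y p.1 ^ (2 * q + 1))).re with hg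
  set h : (Fin m → α) × α → ℝ := fun p =>
    (trace ((Y (p.1 t) - Y p.2) ^ 2 * centredSum Y p.1 ^ (2 * q))).re with hh
  -- The extra sample does not enter the centred sum, so averaging over it kills this term.
  have g0 : ∑ p, g p = 0 := by
    rw [Fintype.sum_prod_type]
    refine Finset.sum_eq_zero fun ω _ => ?_
    simp only [hg]
    rw [← Complex.re_sum, ← trace_sum, ← Finset.sum_mul, sum_centred_eq_zero]
    simp
  have fe : ∑ p, f (exchange t p) = ∑ p, f p := Equiv.sum_comp _ _
  have ge : ∑ p, g (exchange t p) = ∑ p, g p := Equiv.sum_comp _ _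
  have he : ∑ p, h (exchange t p) = ∑ p, h p := Equiv.sum_comp _ _
  have key : ∀ p, f p - g p + f (exchange t p) - g (exchange t p) ≤
      (2 * q + 1) * (h p + h (exchange t p)) := by
    rintro ⟨ω, a⟩
    have hd := centredSum_sub_update Y ω t a
    have := trace_sub_mul_pow_sub_pow_le (centredSum_isHermitian hY ω)
      (centredSum_isHermitian hY (Function.update ω t a)) q
    rw [hd] at this
    refine le_of_eq_of_le ?_ (this.trans_eq ?_)
    · simp only [hf, hg, exchange, Equiv.coe_fn_mk, Function.update_self, ← Complex.sub_re,
        ← Complex.add_re, ← trace_sub, ← trace_add]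
      congr 2
      noncomm_ring
    · simp only [hh, exchange, Equiv.coe_fn_mk, Function.update_self]
      rw [show (Y a - Y (ω t)) ^ 2 = (Y (ω t) - Y a) ^ 2 by rw [← neg_sub, neg_sq]]
  have := Finset.sum_le_sum fun p (_ : p ∈ Finset.univ) => key p
  simp only [← Finset.mul_sum, Finset.sum_sub_distrib, Finset.sum_add_distrib, fe, ge, he, g0]
    at this
  linarith

theorem trace_diagonal_mul_re (d : ι → ℝ) (A : Matrix ι ι ℂ) :
    (trace (diagonal (fun i => (d i : ℂ)) * A)).re = ∑ i, d i * (A i i).re := by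
  simp [trace, diagonal_mul, Complex.re_sum]

/-- A trace moment bound for sums of i.i.d. Hermitian matrices with diagonal squares. -/
theorem sum_trace_centredSum_pow_le [Nonempty α] {Y : α → Matrix ι ι ℂ}
    (hY : ∀ a, (Y a).IsHermitian) {D : α → ι → ℝ} (hD : ∀ a i, 0 ≤ D a i)
    (hYD : ∀ a, Y a * Y a = diagonal fun i => (D a i : ℂ)) (q : ℕ) :
    ∑ ω : Fin m → α, (trace (centredSum Y ω ^ (2 * q + 2))).re ≤
      ∑ ω : Fin m → α, ∑ i, (4 * (2 * q + 1) *
        (∑ t, D (ω t) i + m / Fintype.card α * ∑ a, D a i)) ^ (q + 1) := by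
  have hN : (0 : ℝ) < Fintype.card α := Nat.cast_pos.2 Fintype.card_pos
  set N : ℝ := (Fintype.card α : ℝ) with hNdef
  set w : (Fin m → α) → ι → ℝ := fun ω i => ∑ t, D (ω t) i + m / N * ∑ a, D a i with hw
  have hw0 : ∀ ω i, 0 ≤ w ω i := fun ω i => add_nonneg (Finset.sum_nonneg fun t _ => hD _ _)
    (mul_nonneg (by positivity) (Finset.sum_nonneg fun a _ => hD _ _))
  -- Split off one factor of the power and expand it over `t`; the factor `N` counts the choices of
  -- the extra sample.
  have h1 : N * ∑ ω : Fin m → α, (trace (centredSum Y ω ^ (2 * q + 2))).re =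
      ∑ t : Fin m, ∑ p : (Fin m → α) × α,
        (trace ((Y (p.1 t) - ((Fintype.card α : ℂ))⁻¹ • ∑ a, Y a) *
        centredSum Y p.1 ^ (2 * q + 1))).re := by
    simp only [Fintype.sum_prod_type, Finset.sum_const, Finset.card_univ, nsmul_eq_mul]
    rw [Finset.sum_comm, Finset.mul_sum]
    refine Finset.sum_congr rfl fun ω _ => ?_
    rw [← Finset.mul_sum, ← Complex.re_sum, ← trace_sum, ← Finset.sum_mul, pow_succ' _ (2 * q + 1)]
    rfl
  have h2 : ∀ t : Fin m, ∑ p : (Fin m → α) × α,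
        (trace ((Y (p.1 t) - ((Fintype.card α : ℂ))⁻¹ • ∑ a, Y a) *
        centredSum Y p.1 ^ (2 * q + 1))).re ≤ (2 * q + 1) * ∑ p : (Fin m → α) × α,
        ∑ i, 2 * (D (p.1 t) i + D p.2 i) * ((centredSum Y p.1 ^ (2 * q)) i i).re := by
    intro t
    refine (exchange_bound hY q t).trans ?_
    refine mul_le_mul_of_nonneg_left (Finset.sum_le_sum fun p _ => ?_) (by positivity)
    refine (trace_sub_sq_mul_le (hY _) (hY _) (centredSum_isHermitian hY _) q).trans_eq ?_
    rw [hYD, hYD, trace_diagonal_mul_re, trace_diagonal_mul_re, Finset.mul_sum, Finset.mul_sum,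
      ← Finset.sum_add_distrib]
    exact Finset.sum_congr rfl fun i _ => by ring
  have h3 : ∑ t : Fin m, ∑ p : (Fin m → α) × α,
        ∑ i, 2 * (D (p.1 t) i + D p.2 i) * ((centredSum Y p.1 ^ (2 * q)) i i).re =
      N * ∑ ω : Fin m → α, ∑ i, 2 * w ω i * ((centredSum Y ω ^ (2 * q)) i i).re := by
    simp only [Fintype.sum_prod_type]
    rw [Finset.sum_comm, Finset.mul_sum]
    refine Finset.sum_congr rfl fun ω _ => ?_
    rw [Finset.sum_congr rfl fun t _ => Finset.sum_comm, Finset.sum_comm, Finset.mul_sum]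
    refine Finset.sum_congr rfl fun i _ => ?_
    simp only [hw, ← Finset.sum_mul, ← Finset.mul_sum, Finset.sum_add_distrib, Finset.sum_const,
      Finset.card_univ, nsmul_eq_mul, Fintype.card_fin]
    rw [← hNdef]
    field_simp
  have h4 : N * ∑ ω : Fin m → α, (trace (centredSum Y ω ^ (2 * q + 2))).re ≤
      N * ∑ ω : Fin m → α, ∑ i, (2 * (2 * q + 1) * w ω i) *
        ((centredSum Y ω ^ (2 * q)) i i).re := by
    rw [h1]
    refine (Finset.sum_le_sum fun t _ => h2 t).trans_eq ?_
    rw [← Finset.mul_sum, h3, mul_left_comm, Finset.mul_sum]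
    congr 1
    refine Finset.sum_congr rfl fun ω _ => ?_
    rw [Finset.mul_sum]
    exact Finset.sum_congr rfl fun i _ => by ring
  have h5 := le_of_mul_le_mul_left h4 hN
  -- Half of the moment being estimated reappears here and is absorbed into the left side at the
  -- end, which turns the coefficient `2` into `4`.
  have h6 : ∑ ω : Fin m → α, ∑ i, (2 * (2 * q + 1) * w ω i) *
        ((centredSum Y ω ^ (2 * q)) i i).re ≤
      ∑ ω : Fin m → α, ((trace (centredSum Y ω ^ (2 * q + 2))).re / 2 +
        (∑ i, (4 * (2 * q + 1) * w ω i) ^ (q + 1)) / 2) := by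
    refine Finset.sum_le_sum fun ω _ => ?_
    rw [trace, Complex.re_sum, Finset.sum_div, Finset.sum_div, ← Finset.sum_add_distrib]
    refine Finset.sum_le_sum fun i _ => ?_
    refine (diag_pow_le (centredSum_isHermitian hY ω) q i _
      (mul_nonneg (by positivity) (hw0 ω i))).trans_eq ?_
    rw [diag_apply]
    ring
  rw [Finset.sum_add_distrib, ← Finset.sum_div, ← Finset.sum_div] at h6
  linarith

end Moment

/-! ### Scalar moments from exponential moments -/

section Scalar

/-- The `p`-th power of `z ≤ exp z` at `z = θ x / p`. -/
theorem pow_le_mul_exp {x θ : ℝ} (hx : 0 ≤ x) (hθ : 0 < θ) {p : ℕ} (hp : 0 < p) :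
    x ^ p ≤ (p / θ) ^ p * Real.exp (θ * x) := by
  have hp' : (0 : ℝ) < p := Nat.cast_pos.2 hp
  have h : θ * x / p ≤ Real.exp (θ * x / p) := by linarith [Real.add_one_le_exp (θ * x / p)]
  have h2 := pow_le_pow_left₀ (by positivity) h p
  rw [← Real.exp_nat_mul, show (p : ℝ) * (θ * x / p) = θ * x by field_simp] at h2
  calc x ^ p = (p / θ) ^ p * (θ * x / p) ^ p := by
        rw [← mul_pow]; congr 1; field_simp
    _ ≤ _ := by gcongr

/-- Moments of a sum of i.i.d. nonnegative bounded random variables. -/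
theorem sum_moment_le {α : Type*} [Fintype α] [Nonempty α] {m : ℕ} {D : α → ℝ} (hD : ∀ a, 0 ≤ D a)
    {θ v : ℝ} (hθ : 0 < θ) (hD1 : ∀ a, θ * D a ≤ 1) (hDv : ∑ a, D a ≤ Fintype.card α * v) {p : ℕ}
    (hp : 0 < p) :
    ∑ ω : Fin m → α, (∑ t, D (ω t) + m / Fintype.card α * ∑ a, D a) ^ p ≤
      (Fintype.card α : ℝ) ^ m * ((p / θ) ^ p * Real.exp (3 * (θ * (m * v)))) := by
  have hN : (0 : ℝ) < Fintype.card α := Nat.cast_pos.2 Fintype.card_pos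
  have hmean : m / Fintype.card α * ∑ a, D a ≤ m * v := by
    calc _ ≤ m / Fintype.card α * (Fintype.card α * v) := by gcongr
      _ = m * v := by field_simp
  -- On `[0, 1]` the exponential lies below `1 + 2z`. The resulting `2θv` per sample and the `θv`
  -- from the mean add up to the `3` in the conclusion.
  have hexp : ∑ a, Real.exp (θ * D a) ≤ Fintype.card α * Real.exp (2 * θ * v) := by
    calc ∑ a, Real.exp (θ * D a) ≤ ∑ a, (1 + 2 * θ * D a) := by
          refine Finset.sum_le_sum fun a _ => ?_
          have h0 : 0 ≤ θ * D a := mul_nonneg hθ.le (hD a)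
          have := Real.abs_exp_sub_one_le (x := θ * D a) (by rw [abs_of_nonneg h0]; exact hD1 a)
          rw [abs_of_nonneg h0] at this
          linarith [le_abs_self (Real.exp (θ * D a) - 1)]
      _ = Fintype.card α + 2 * θ * ∑ a, D a := by
          rw [Finset.sum_add_distrib, ← Finset.mul_sum]; simp
      _ ≤ Fintype.card α + 2 * θ * (Fintype.card α * v) := by gcongr
      _ = Fintype.card α * (2 * θ * v + 1) := by ring
      _ ≤ _ := by gcongr; exact Real.add_one_le_exp _
  have hprod : ∑ ω : Fin m → α, Real.exp (θ * ∑ t, D (ω t)) =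
      (∑ a, Real.exp (θ * D a)) ^ m := by
    rw [Fintype.sum_pow]
    exact Finset.sum_congr rfl fun ω _ => by rw [Finset.mul_sum, Real.exp_sum]
  calc _ ≤ ∑ ω : Fin m → α, (p / θ) ^ p *
        (Real.exp (θ * (m * v)) * Real.exp (θ * ∑ t, D (ω t))) := by
        refine Finset.sum_le_sum fun ω _ => ?_
        refine (pow_le_mul_exp (add_nonneg (Finset.sum_nonneg fun t _ => hD _)
          (mul_nonneg (by positivity) (Finset.sum_nonneg fun a _ => hD a))) hθ hp).trans ?_
        rw [← Real.exp_add]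
        gcongr
        rw [mul_add, add_comm]
        gcongr
    _ = (p / θ) ^ p * (Real.exp (θ * (m * v)) * (∑ a, Real.exp (θ * D a)) ^ m) := by
        rw [← hprod, Finset.mul_sum, Finset.mul_sum]
    _ ≤ (p / θ) ^ p * (Real.exp (θ * (m * v)) *
          (Fintype.card α * Real.exp (2 * θ * v)) ^ m) := by gcongr
    _ = (Fintype.card α : ℝ) ^ m * ((p / θ) ^ p *
          (Real.exp (θ * (m * v)) * Real.exp (m * (2 * θ * v)))) := by
        rw [mul_pow, Real.exp_nat_mul]; ring
    _ = _ := by rw [← Real.exp_add]; ring_nf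

end Scalar

/-! ### Concentration for sampled colours -/

section Sampling

variable {ι κ α : Type*} [DecidableEq α]

/-- The part of `M` whose entries have the colour `a`. -/
def colourPart (M : Matrix ι κ ℂ) (φ : ι → κ → α) (a : α) : Matrix ι κ ℂ :=
  Matrix.of fun i c => if φ i c = a then M i c else 0

/-- The Hermitian dilation of a rectangular matrix. -/
def dilation (A : Matrix ι κ ℂ) : Matrix (ι ⊕ κ) (ι ⊕ κ) ℂ := fromBlocks 0 A Aᴴ 0

theorem dilation_isHermitian (A : Matrix ι κ ℂ) : (dilation A).IsHermitian := by
  simp [dilation, IsHermitian, fromBlocks_conjTranspose]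

variable [Fintype ι] [Fintype κ]

/-- The diagonal of the square of the dilation of a colour part. -/
noncomputable def colourWeight (M : Matrix ι κ ℂ) (φ : ι → κ → α) (a : α) : ι ⊕ κ → ℝ :=
  Sum.elim (fun i => ∑ c, if φ i c = a then ‖M i c‖ ^ 2 else 0)
    (fun c => ∑ i, if φ i c = a then ‖M i c‖ ^ 2 else 0)

theorem colourWeight_nonneg (M : Matrix ι κ ℂ) (φ : ι → κ → α) (a : α) (x : ι ⊕ κ) :
    0 ≤ colourWeight M φ a x := by
  rcases x with i | c <;> exact Finset.sum_nonneg fun _ _ => by split_ifs <;> positivity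

theorem sum_ite_le_of_injective {β : Type*} [Fintype β] {f : β → α} (hf : Function.Injective f)
    (a : α) {g : β → ℝ} {B : ℝ} (hB : 0 ≤ B) (hg : ∀ b, g b ≤ B) :
    ∑ b, (if f b = a then g b else 0) ≤ B := by
  by_cases h : ∃ b, f b = a
  · obtain ⟨b, rfl⟩ := h
    rw [Finset.sum_eq_single b]
    · simpa using hg b
    · intro c _ hc
      rw [if_neg fun h => hc (hf h)]
    · simp
  · push Not at h
    simpa [h] using hB

theorem colourWeight_le {M : Matrix ι κ ℂ} {φ : ι → κ → α}
    (hrow : ∀ i, Function.Injective (φ i)) (hcol : ∀ c, Function.Injective fun i => φ i c) {B : ℝ}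
    (hB : ∀ i c, ‖M i c‖ ^ 2 ≤ B) (hB0 : 0 ≤ B) (a : α) (x : ι ⊕ κ) :
    colourWeight M φ a x ≤ B := by
  rcases x with i | c
  · exact sum_ite_le_of_injective (hrow i) a hB0 fun c => hB i c
  · exact sum_ite_le_of_injective (hcol c) a hB0 fun i => hB i c

theorem sum_colourWeight_le [Fintype α] {M : Matrix ι κ ℂ} {φ : ι → κ → α} {B : ℝ}
    (hrow : ∀ i, ∑ c, ‖M i c‖ ^ 2 ≤ B) (hcol : ∀ c, ∑ i, ‖M i c‖ ^ 2 ≤ B) (x : ι ⊕ κ) :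
    ∑ a, colourWeight M φ a x ≤ B := by
  rcases x with i | c
  · simp only [colourWeight, Sum.elim_inl]
    rw [Finset.sum_comm]
    simpa using hrow i
  · simp only [colourWeight, Sum.elim_inr]
    rw [Finset.sum_comm]
    simpa using hcol c

variable [DecidableEq ι] [DecidableEq κ]

/-- Distinct rows of a colour part have disjoint supports, and so do distinct columns; hence both
Gram matrices are diagonal. -/
theorem dilation_mul_self (M : Matrix ι κ ℂ) {φ : ι → κ → α}
    (hrow : ∀ i, Function.Injective (φ i)) (hcol : ∀ c, Function.Injective fun i => φ i c) (a : α) :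
    dilation (colourPart M φ a) * dilation (colourPart M φ a) =
      diagonal fun x => (colourWeight M φ a x : ℂ) := by
  have e : (diagonal fun x => (colourWeight M φ a x : ℂ)) =
      fromBlocks (diagonal fun i => (colourWeight M φ a (.inl i) : ℂ)) 0 0
        (diagonal fun c => (colourWeight M φ a (.inr c) : ℂ)) := by
    rw [fromBlocks_diagonal]
    congr 1
    ext (x | x) <;> rfl
  rw [e, dilation, fromBlocks_multiply]
  simp only [Matrix.mul_zero, Matrix.zero_mul, zero_add, add_zero]
  congr 1
  · ext i j
    rw [Matrix.mul_apply]
    rcases eq_or_ne i j with rfl | hij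
    · rw [diagonal_apply_eq]
      simp only [colourWeight, Sum.elim_inl]
      push_cast
      refine Finset.sum_congr rfl fun c _ => ?_
      simp only [colourPart, conjTranspose_apply, of_apply]
      split_ifs
      · rw [Complex.star_def, Complex.mul_conj', Complex.ofReal_pow]
      · simp
    · rw [diagonal_apply_ne _ hij]
      refine Finset.sum_eq_zero fun c _ => ?_
      simp only [colourPart, conjTranspose_apply, of_apply]
      split_ifs with h1 h2
      · exact absurd (hcol c (h1.trans h2.symm)) hij
      all_goals simp
  · ext i j
    rw [Matrix.mul_apply]
    rcases eq_or_ne i j with rfl | hij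
    · rw [diagonal_apply_eq]
      simp only [colourWeight, Sum.elim_inr]
      push_cast
      refine Finset.sum_congr rfl fun c _ => ?_
      simp only [colourPart, conjTranspose_apply, of_apply]
      split_ifs
      · rw [Complex.star_def, Complex.conj_mul', Complex.ofReal_pow]
      · simp
    · rw [diagonal_apply_ne _ hij]
      refine Finset.sum_eq_zero fun c _ => ?_
      simp only [colourPart, conjTranspose_apply, of_apply]
      split_ifs with h1 h2
      · exact absurd (hrow c (h1.trans h2.symm)) hij
      all_goals simp

open scoped Matrix.Norms.L2Operator in
theorem specNorm_nonneg {ι κ : Type*} [Fintype ι] [Fintype κ] [DecidableEq κ] (A : Matrix ι κ ℂ) :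
    0 ≤ specNorm A := norm_nonneg A

-- Test the dilation on vectors supported in the second block.
open scoped Matrix.Norms.L2Operator in
theorem norm_le_norm_dilation (A : Matrix ι κ ℂ) : ‖A‖ ≤ ‖dilation A‖ := by
  rw [l2_opNorm_def]
  refine ContinuousLinearMap.opNorm_le_bound _ (norm_nonneg _) fun x => ?_
  have h := l2_opNorm_mulVec (dilation A)
    (WithLp.toLp 2 (Sum.elim 0 x.ofLp) : EuclideanSpace ℂ (ι ⊕ κ))
  have e1 : ‖(WithLp.toLp 2 (Sum.elim 0 x.ofLp) : EuclideanSpace ℂ (ι ⊕ κ))‖ = ‖x‖ := by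
    simp [EuclideanSpace.norm_eq]
  rw [e1] at h
  refine le_of_eq_of_le ?_ h
  simp [EuclideanSpace.norm_eq, dilation, fromBlocks_mulVec, toEuclideanLin]

theorem sum_colourPart {ι κ α : Type*} [Fintype α] [DecidableEq α] (M : Matrix ι κ ℂ)
    (φ : ι → κ → α) : ∑ a, colourPart M φ a = M := by
  ext i c
  simp [colourPart, Matrix.sum_apply]

/-- The Hermitian dilation as a real linear map. -/
def dilationLinear (ι κ : Type*) : Matrix ι κ ℂ →ₗ[ℝ] Matrix (ι ⊕ κ) (ι ⊕ κ) ℂ where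
  toFun := dilation
  map_add' A B := by simp [dilation, fromBlocks_add]
  map_smul' c A := by
    simp [dilation, fromBlocks_smul, conjTranspose_smul]

theorem centredSum_dilation {ι κ α : Type*} [Fintype α] [DecidableEq α] {m : ℕ}
    (M : Matrix ι κ ℂ) (φ : ι → κ → α) (ω : Fin m → α) :
    centredSum (fun a => dilation (colourPart M φ a)) ω =
      dilation (∑ t, colourPart M φ (ω t) - ((m : ℂ) / Fintype.card α) • M) := by
  have hd : ∀ A : Matrix ι κ ℂ, dilation A = dilationLinear ι κ A := fun _ => rfl
  -- The dilation involves `Aᴴ` and is only real linear, so the scalars must be seen as real.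
  have h1 : ((m : ℂ) / Fintype.card α) • M = ((m : ℝ) / Fintype.card α) • M := by
    rw [← Complex.coe_smul]; push_cast; rfl
  have h2 : ∀ A : Matrix (ι ⊕ κ) (ι ⊕ κ) ℂ,
      ((Fintype.card α : ℂ))⁻¹ • A = ((Fintype.card α : ℝ))⁻¹ • A := fun A => by
    rw [← Complex.coe_smul]; push_cast; rfl
  rw [h1]
  simp only [centredSum, hd, map_sub, map_sum, map_smul, h2]
  rw [← map_sum, sum_colourPart, Finset.sum_sub_distrib, Finset.sum_const, Finset.card_univ,
    Fintype.card_fin, ← Nat.cast_smul_eq_nsmul ℝ, smul_smul, div_eq_mul_inv]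

variable [Fintype α] {m : ℕ}

open scoped Matrix.Norms.L2Operator in
/-- A concentration bound for sampling the colours of a matrix. -/
theorem card_colour_sampling_le [Nonempty α] {M : Matrix ι κ ℂ} {φ : ι → κ → α}
    (hrow : ∀ i, Function.Injective (φ i)) (hcol : ∀ c, Function.Injective fun i => φ i c)
    {B τ : ℝ} (hB : 0 < B) (hτ : 0 < τ) (hM : ∀ i c, ‖M i c‖ ≤ B * τ)
    (hMrow : ∀ i, ∑ c, ‖M i c‖ ^ 2 ≤ Fintype.card α * (B * τ ^ 2))
    (hMcol : ∀ c, ∑ i, ‖M i c‖ ^ 2 ≤ Fintype.card α * (B * τ ^ 2))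
    (hα : 2 ≤ Fintype.card α) (hm : 0 < m) (hmB : B * Real.log (Fintype.card α) ≤ m) :
    ((Finset.univ.filter fun ω : Fin m → α =>
      √(72 * Real.exp 8) * √(B * Real.log (Fintype.card α) / m) * (m * τ) <
        specNorm (∑ t, colourPart M φ (ω t) - ((m : ℂ) / Fintype.card α) • M)).card : ℝ) ≤
      (Fintype.card ι + Fintype.card κ) * (Fintype.card α : ℝ) ^ m *
        ((Fintype.card α : ℝ) ^ 5)⁻¹ := by
  set N : ℝ := (Fintype.card α : ℝ) with hN
  have hN2 : (2 : ℝ) ≤ N := by rw [hN]; exact_mod_cast hα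
  set l : ℝ := Real.log N with hl
  have hl2 : 1 / 2 ≤ l := by
    have := Real.log_le_log (by norm_num) hN2
    linarith [Real.log_two_gt_d9]
  have hl0 : 0 < l := by linarith
  have hm' : (0 : ℝ) < m := Nat.cast_pos.2 hm
  set v : ℝ := B * τ ^ 2 with hv
  have hv0 : 0 < v := by positivity
  set u : ℝ := √(72 * Real.exp 8) * √(B * l / m) * (m * τ) with hu
  have hu0 : 0 < u := by positivity
  have hu2 : u ^ 2 = 72 * Real.exp 8 * (l * (m * v)) := by
    rw [hu, mul_pow, mul_pow, Real.sq_sqrt (by positivity), Real.sq_sqrt (by positivity), hv]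
    field_simp
  obtain ⟨q, hq⟩ : ∃ q, ⌈l⌉₊ = q + 1 :=
    Nat.exists_eq_succ_of_ne_zero (Nat.ceil_pos.2 hl0).ne'
  have hp1 : l ≤ (q + 1 : ℝ) := by
    have := Nat.le_ceil l
    rw [hq] at this
    exact_mod_cast this
  -- From `⌈l⌉ < l + 1` and `1 ≤ 2l`, the latter because `N ≥ 2`.
  have hp2 : (q + 1 : ℝ) ≤ 3 * l := by
    have := Nat.ceil_lt_add_one hl0.le
    rw [hq] at this
    push_cast at this
    linarith
  -- This makes `θ m v = l`, so the exponential factor is `N ^ 3`, while `θ D ≤ B l / m ≤ 1` is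
  -- exactly the sample size hypothesis.
  set θ : ℝ := l / (m * v) with hθ
  have hθ0 : 0 < θ := by positivity
  have hY := fun a => dilation_isHermitian (colourPart M φ a)
  have hmom := sum_trace_centredSum_pow_le (m := m) hY (colourWeight_nonneg M φ)
    (dilation_mul_self M hrow hcol) q
  have hscal : ∀ x, ∑ ω : Fin m → α, (∑ t, colourWeight M φ (ω t) x +
      m / Fintype.card α * ∑ a, colourWeight M φ a x) ^ (q + 1) ≤
      N ^ m * (((q + 1 : ℝ) / θ) ^ (q + 1) * Real.exp (3 * l)) := by
    intro x
    have := sum_moment_le (m := m) (D := fun a => colourWeight M φ a x)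
      (fun a => colourWeight_nonneg M φ a x) (v := v) hθ0 (fun a => ?_)
      (sum_colourWeight_le hMrow hMcol x) (p := q + 1) (Nat.succ_pos q)
    · rw [show θ * (m * v) = l by rw [hθ]; field_simp] at this
      rw [← hN] at this
      push_cast at this
      exact this
    · have h1 : colourWeight M φ a x ≤ B * v := by
        refine colourWeight_le hrow hcol (fun i c => ?_) (by positivity) a x
        calc ‖M i c‖ ^ 2 ≤ (B * τ) ^ 2 := by gcongr; exact hM i c
          _ = B * v := by rw [hv]; ring
      calc θ * colourWeight M φ a x ≤ θ * (B * v) := by gcongr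
        _ = B * l / m := by rw [hθ]; field_simp
        _ ≤ 1 := by rw [div_le_one hm']; exact hmB
  have hmarkov : ((Finset.univ.filter fun ω : Fin m → α => u <
        specNorm (∑ t, colourPart M φ (ω t) - ((m : ℂ) / Fintype.card α) • M)).card : ℝ) *
          u ^ (2 * q + 2) ≤
      ∑ ω : Fin m → α,
        (trace (centredSum (fun a => dilation (colourPart M φ a)) ω ^ (2 * q + 2))).re := by
    rw [← nsmul_eq_mul]
    have hle : ∀ ω : Fin m → α,
        specNorm (∑ t, colourPart M φ (ω t) - ((m : ℂ) / Fintype.card α) • M) ^ (2 * q + 2) ≤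
        (trace (centredSum (fun a => dilation (colourPart M φ a)) ω ^ (2 * q + 2))).re := by
      intro ω
      refine le_trans ?_ (norm_pow_le_trace (centredSum_isHermitian hY ω) q)
      rw [centredSum_dilation]
      exact pow_le_pow_left₀ (specNorm_nonneg _) (norm_le_norm_dilation _) _
    refine (Finset.card_nsmul_le_sum _ _ _ fun ω hω => ?_).trans
      (Finset.sum_le_sum_of_subset_of_nonneg (Finset.subset_univ _) fun ω _ _ => ?_)
    · exact (pow_le_pow_left₀ hu0.le (Finset.mem_filter.1 hω).2.le _).trans (hle ω)
    · exact le_trans (pow_nonneg (specNorm_nonneg _) _) (hle ω)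
  have htotal := hmarkov.trans hmom
  rw [Finset.sum_comm] at htotal
  simp only [mul_pow (4 * (2 * (q : ℝ) + 1)), ← Finset.mul_sum] at htotal
  have hfin : (4 * (2 * (q : ℝ) + 1)) ^ (q + 1) * ∑ x, ∑ ω : Fin m → α,
      (∑ t, colourWeight M φ (ω t) x + m / Fintype.card α * ∑ a, colourWeight M φ a x) ^ (q + 1) ≤
      (Fintype.card ι + Fintype.card κ) * N ^ m * (N ^ 5)⁻¹ * u ^ (2 * q + 2) := by
    -- With `2q + 1 ≤ 6l` and `q + 1 ≤ 3l` the constant is `4 · 6 · 3 = 72`; the spare `exp 8` in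
    -- `u²` provides the decay.
    have hratio : 4 * (2 * (q : ℝ) + 1) * ((q + 1 : ℝ) / θ) ≤ u ^ 2 * Real.exp (-8) := by
      have : u ^ 2 * Real.exp (-8) = 72 * (l * (m * v)) := by
        rw [hu2, mul_right_comm, mul_assoc 72, ← Real.exp_add]; simp
      rw [this, hθ]
      calc 4 * (2 * (q : ℝ) + 1) * ((q + 1 : ℝ) / (l / (m * v)))
          ≤ 4 * (2 * (3 * l)) * ((3 * l) / (l / (m * v))) := by
            gcongr
            linarith
        _ = _ := by field_simp; ring
    -- As `q + 1 ≥ l`, the decay `N ^ (-8)` beats the loss `N ^ 3`.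
    have hexp : Real.exp (-8) ^ (q + 1) * Real.exp (3 * l) ≤ (N ^ 5)⁻¹ := by
      have : (N ^ 5)⁻¹ = Real.exp (-(5 * l)) := by
        rw [Real.exp_neg, show 5 * l = ((5 : ℕ) : ℝ) * l by norm_num, Real.exp_nat_mul, hl,
          Real.exp_log (by linarith)]
      rw [this, ← Real.exp_nat_mul, ← Real.exp_add]
      gcongr
      push_cast
      linarith
    calc _ ≤ (4 * (2 * (q : ℝ) + 1)) ^ (q + 1) * ∑ x : ι ⊕ κ,
          N ^ m * (((q + 1 : ℝ) / θ) ^ (q + 1) * Real.exp (3 * l)) := by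
          gcongr with x _
          exact hscal x
      _ = (Fintype.card ι + Fintype.card κ) * N ^ m *
          ((4 * (2 * (q : ℝ) + 1) * ((q + 1 : ℝ) / θ)) ^ (q + 1) * Real.exp (3 * l)) := by
          rw [Finset.sum_const, Finset.card_univ, Fintype.card_sum, nsmul_eq_mul]
          rw [mul_pow (4 * (2 * (q : ℝ) + 1))]
          push_cast
          ring
      _ ≤ (Fintype.card ι + Fintype.card κ) * N ^ m *
          ((u ^ 2 * Real.exp (-8)) ^ (q + 1) * Real.exp (3 * l)) := by gcongr
      _ = (Fintype.card ι + Fintype.card κ) * N ^ m * u ^ (2 * q + 2) *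
          (Real.exp (-8) ^ (q + 1) * Real.exp (3 * l)) := by
          rw [mul_pow, ← pow_mul, show 2 * (q + 1) = 2 * q + 2 by ring]; ring
      _ ≤ (Fintype.card ι + Fintype.card κ) * N ^ m * u ^ (2 * q + 2) * (N ^ 5)⁻¹ := by gcongr
      _ = _ := by ring
  exact le_of_mul_le_mul_right (htotal.trans hfin) (by positivity)

end Sampling

/-! ### Row and entry bounds from an orthonormal factor -/

section Incoherence

theorem sq_norm_le_rowNorm_sq {ι γ : Type*} [Finite ι] [Fintype γ] (L : Matrix ι γ ℂ) {β : ℝ}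
    (hL : rowNorm L ≤ β) (i : ι) : ∑ k, ‖L i k‖ ^ 2 ≤ β ^ 2 := by
  have h : ‖(WithLp.toLp 2 (L i) : EuclideanSpace ℂ γ)‖ ≤ β :=
    (le_ciSup (Set.finite_range fun i => ‖(WithLp.toLp 2 (L i) : EuclideanSpace ℂ γ)‖).bddAbove
      i).trans hL
  rw [← EuclideanSpace.norm_sq_eq (WithLp.toLp 2 (L i))]
  exact pow_le_pow_left₀ (norm_nonneg _) h 2

variable {ι γ κ : Type*} [Fintype ι] [Fintype γ] [DecidableEq γ]

theorem conjTranspose_mul_self_of_isometry {A : Matrix ι κ ℂ} {L : Matrix ι γ ℂ}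
    {G : Matrix γ κ ℂ} (hL : Lᴴ * L = 1) (hA : A = L * G) : Aᴴ * A = Gᴴ * G := by
  rw [hA, conjTranspose_mul, Matrix.mul_assoc, ← Matrix.mul_assoc Lᴴ, hL, Matrix.one_mul]

theorem sum_sq_norm_col_eq {A : Matrix ι κ ℂ} {L : Matrix ι γ ℂ} {G : Matrix γ κ ℂ}
    (hL : Lᴴ * L = 1) (hA : A = L * G) (c : κ) :
    ∑ k, ‖G k c‖ ^ 2 = ∑ i, ‖A i c‖ ^ 2 := by
  have h := congrFun (congrFun (conjTranspose_mul_self_of_isometry hL hA) c) c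
  simp only [Matrix.mul_apply, conjTranspose_apply, Complex.star_def, Complex.conj_mul'] at h
  exact_mod_cast h.symm

/-- Cauchy–Schwarz on row `i` of `L` against column `c` of `G`, whose norm is that of column `c` of
`A` because `L` is an isometry. -/
theorem sq_norm_entry_le {A : Matrix ι κ ℂ} {L : Matrix ι γ ℂ} {G : Matrix γ κ ℂ} {β : ℝ}
    (hL : Lᴴ * L = 1) (hA : A = L * G) (hβ : rowNorm L ≤ β) (i : ι) (c : κ) :
    ‖A i c‖ ^ 2 ≤ β ^ 2 * ∑ i', ‖A i' c‖ ^ 2 := by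
  rw [← sum_sq_norm_col_eq hL hA]
  have h1 : ‖A i c‖ ≤ ∑ k, ‖L i k‖ * ‖G k c‖ := by
    rw [hA, Matrix.mul_apply]
    exact (norm_sum_le _ _).trans_eq (Finset.sum_congr rfl fun k _ => norm_mul _ _)
  calc ‖A i c‖ ^ 2 ≤ (∑ k, ‖L i k‖ * ‖G k c‖) ^ 2 := by gcongr
    _ ≤ (∑ k, ‖L i k‖ ^ 2) * ∑ k, ‖G k c‖ ^ 2 := Finset.sum_mul_sq_le_sq_mul_sq _ _ _
    _ ≤ _ := by gcongr; exact sq_norm_le_rowNorm_sq L hβ i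

variable [Fintype κ] [DecidableEq κ]

-- Row `i` of `A` is row `i` of `L` times `G`, and `G` has the spectral norm of `A` because `L` is
-- an isometry.
open scoped Matrix.Norms.L2Operator in
theorem sum_sq_norm_row_le {A : Matrix ι κ ℂ} {L : Matrix ι γ ℂ} {G : Matrix γ κ ℂ} {β : ℝ}
    (hL : Lᴴ * L = 1) (hA : A = L * G) (hβ : rowNorm L ≤ β) (i : ι) :
    ∑ c, ‖A i c‖ ^ 2 ≤ β ^ 2 * specNorm A ^ 2 := by
  have hG : ‖G‖ = specNorm A := by
    have h := congrArg norm (conjTranspose_mul_self_of_isometry hL hA)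
    rw [l2_opNorm_conjTranspose_mul_self, l2_opNorm_conjTranspose_mul_self] at h
    exact (mul_self_inj (norm_nonneg _) (norm_nonneg _)).1 h.symm
  have h := l2_opNorm_mulVec Gᴴ (WithLp.toLp 2 (star (L i)) : EuclideanSpace ℂ γ)
  rw [l2_opNorm_conjTranspose, hG] at h
  have h2 := pow_le_pow_left₀ (norm_nonneg _) h 2
  rw [mul_pow, EuclideanSpace.norm_sq_eq, EuclideanSpace.norm_sq_eq] at h2
  have e1 : ∀ c, ‖((EuclideanSpace.equiv κ ℂ).symm
      (Gᴴ *ᵥ (WithLp.toLp 2 (star (L i)) : EuclideanSpace ℂ γ).ofLp)) c‖ = ‖A i c‖ := by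
    intro c
    rw [← norm_star (A i c), hA, Matrix.mul_apply, star_sum]
    simp [mulVec, dotProduct, mul_comm]
  simp only [e1] at h2
  refine h2.trans ?_
  rw [mul_comm]
  gcongr
  simpa using sq_norm_le_rowNorm_sq L hβ i

end Incoherence

/-! ### Hankel tensors: incoherence bounds and the error as colour sampling -/

section Tensor

variable {n₁ n₂ s r : ℕ}

theorem mat1_tucker (L : Matrix (Fin n₁) (Fin r) ℂ) (R : Matrix (Fin n₂) (Fin r) ℂ)
    (V : Matrix (Fin s) (Fin r) ℂ) (S : Tensor3 r r r) :
    mat1 (tucker L R V S) =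
      L * Matrix.of fun i c => ∑ k, (∑ j, S i j k * R c.2 j) * V c.1 k := by
  ext i c
  simp only [mat1, tucker, modeProd1, modeProd2, modeProd3, Matrix.mul_apply, of_apply,
    Finset.sum_mul, Finset.mul_sum]
  rw [Finset.sum_congr rfl fun k _ => Finset.sum_comm, Finset.sum_comm]
  exact Finset.sum_congr rfl fun _ _ => Finset.sum_congr rfl fun _ _ =>
    Finset.sum_congr rfl fun _ _ => by ring

theorem mat2_tucker (L : Matrix (Fin n₁) (Fin r) ℂ) (R : Matrix (Fin n₂) (Fin r) ℂ)
    (V : Matrix (Fin s) (Fin r) ℂ) (S : Tensor3 r r r) :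
    mat2 (tucker L R V S) =
      R * Matrix.of fun j c => ∑ k, (∑ i, S i j k * L c.2 i) * V c.1 k := by
  ext j c
  simp only [mat2, tucker, modeProd1, modeProd2, modeProd3, Matrix.mul_apply, of_apply,
    Finset.sum_mul, Finset.mul_sum]
  rw [Finset.sum_comm]
  exact Finset.sum_congr rfl fun _ _ => Finset.sum_congr rfl fun _ _ =>
    Finset.sum_congr rfl fun _ _ => by ring

theorem sigmaMax_nonneg (Z : Tensor3 n₁ n₂ s) : 0 ≤ sigmaMax Z :=
  (specNorm_nonneg _).trans (le_max_left _ _)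

/-- Rows are controlled by the factors `L` and `R`. A column of one matricization is a piece of a
row of the other, so columns inherit the row bound; an entry gains one more `β` over its column. -/
theorem IsIncoherent.bounds {μ₀ : ℝ} {Z : Tensor3 n₁ n₂ s} (hZ : IsIncoherent μ₀ r Z) {β : ℝ}
    (hβ : β = √(μ₀ * symConst n₁ n₂ * r / ((n₁ + n₂ - 1 : ℕ) : ℝ))) :
    (∀ i, ∑ c, ‖mat1 Z i c‖ ^ 2 ≤ β ^ 2 * sigmaMax Z ^ 2) ∧
    (∀ j, ∑ c, ‖mat2 Z j c‖ ^ 2 ≤ β ^ 2 * sigmaMax Z ^ 2) ∧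
    (∀ c, ∑ i, ‖mat1 Z i c‖ ^ 2 ≤ β ^ 2 * sigmaMax Z ^ 2) ∧
    (∀ c, ∑ j, ‖mat2 Z j c‖ ^ 2 ≤ β ^ 2 * sigmaMax Z ^ 2) ∧
    ∀ i j k, ‖Z i j k‖ ≤ β ^ 2 * sigmaMax Z := by
  obtain ⟨-, -, L, R, V, S, hL, hR, -, hT, hLβ, hRβ⟩ := hZ
  rw [← hβ] at hLβ hRβ
  have h1 := mat1_tucker L R V S
  have h2 := mat2_tucker L R V S
  rw [← hT] at h1 h2
  have r1 : ∀ i, ∑ c, ‖mat1 Z i c‖ ^ 2 ≤ β ^ 2 * sigmaMax Z ^ 2 := fun i =>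
    (sum_sq_norm_row_le hL h1 hLβ i).trans (by
      gcongr
      · exact specNorm_nonneg _
      · exact le_max_left _ _)
  have r2 : ∀ j, ∑ c, ‖mat2 Z j c‖ ^ 2 ≤ β ^ 2 * sigmaMax Z ^ 2 := fun j =>
    (sum_sq_norm_row_le hR h2 hRβ j).trans (by
      gcongr
      · exact specNorm_nonneg _
      · exact (le_max_left _ _).trans (le_max_right _ _))
  have c1 : ∀ c, ∑ i, ‖mat1 Z i c‖ ^ 2 ≤ β ^ 2 * sigmaMax Z ^ 2 := fun c => by
    refine le_trans ?_ (r2 c.2)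
    rw [Fintype.sum_prod_type]
    exact Finset.single_le_sum (f := fun k => ∑ i, ‖mat2 Z c.2 (k, i)‖ ^ 2)
      (fun k _ => Finset.sum_nonneg fun i _ => by positivity) (Finset.mem_univ c.1)
  have c2 : ∀ c, ∑ j, ‖mat2 Z j c‖ ^ 2 ≤ β ^ 2 * sigmaMax Z ^ 2 := fun c => by
    refine le_trans ?_ (r1 c.2)
    rw [Fintype.sum_prod_type]
    exact Finset.single_le_sum (f := fun k => ∑ j, ‖mat1 Z c.2 (k, j)‖ ^ 2)
      (fun k _ => Finset.sum_nonneg fun i _ => by positivity) (Finset.mem_univ c.1)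
  refine ⟨r1, r2, c1, c2, fun i j k => ?_⟩
  have hs := sigmaMax_nonneg Z
  refine (sq_le_sq₀ (norm_nonneg _) (by positivity)).1 ?_
  calc ‖Z i j k‖ ^ 2 ≤ β ^ 2 * ∑ i', ‖mat1 Z i' (k, j)‖ ^ 2 :=
        sq_norm_entry_le hL h1 hLβ i (k, j)
    _ ≤ β ^ 2 * (β ^ 2 * sigmaMax Z ^ 2) := by gcongr; exact c1 _
    _ = _ := by ring

/-- The adjoint sums `w_a` equal entries and divides by `√w_a`; lifting divides by `√w_a` again, so
all weights cancel. -/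
theorem lift_sampling_liftAdj_hankel {m : ℕ} (ω : Fin m → Fin s × Fin (n₁ + n₂ - 1))
    (X : Matrix (Fin s) (Fin (n₁ + n₂ - 1)) ℂ) (i : Fin n₁) (j : Fin n₂) (k : Fin s) :
    (lift (sampling ω (liftAdj (hankel X))) : Tensor3 n₁ n₂ s) i j k =
      ∑ t, if (k, skewIdx i j) = ω t then hankel X i j k else 0 := by
  have hsum : (∑ i' : Fin n₁, ∑ j' : Fin n₂,
      if skewIdx i' j' = skewIdx i j then (hankel X : Tensor3 n₁ n₂ s) i' j' k else 0) =
      skewLen n₁ n₂ (skewIdx i j) * X k (skewIdx i j) := by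
    rw [← Fintype.sum_prod_type'
      (f := fun i' j' => if skewIdx i' j' = skewIdx i j then hankel X i' j' k else 0),
      ← Finset.sum_filter, skewLen, ← nsmul_eq_mul, ← Finset.sum_const]
    refine Finset.sum_congr rfl fun q hq => ?_
    rw [hankel, (Finset.mem_filter.1 hq).2]
  have hpos : (0 : ℝ) < skewLen n₁ n₂ (skewIdx i j) :=
    Nat.cast_pos.2 (Finset.card_pos.2 ⟨(i, j), by simp⟩)
  have hw : ((√(skewLen n₁ n₂ (skewIdx i j)) : ℝ) : ℂ)⁻¹ *
      (((√(skewLen n₁ n₂ (skewIdx i j)) : ℝ) : ℂ)⁻¹ *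
        (skewLen n₁ n₂ (skewIdx i j) * X k (skewIdx i j))) = X k (skewIdx i j) := by
    have hne : ((√(skewLen n₁ n₂ (skewIdx i j)) : ℝ) : ℂ) ≠ 0 :=
      Complex.ofReal_ne_zero.2 (Real.sqrt_pos.2 hpos).ne'
    have hsq : ((skewLen n₁ n₂ (skewIdx i j) : ℕ) : ℂ) =
        ((√(skewLen n₁ n₂ (skewIdx i j)) : ℝ) : ℂ) * ((√(skewLen n₁ n₂ (skewIdx i j)) : ℝ) : ℂ) := by
      rw [← Complex.ofReal_mul, Real.mul_self_sqrt hpos.le, Complex.ofReal_natCast]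
    rw [hsq]
    field_simp
  have hA : (liftAdj (hankel X : Tensor3 n₁ n₂ s)) k (skewIdx i j) =
      ((√(skewLen n₁ n₂ (skewIdx i j)) : ℝ) : ℂ)⁻¹ *
        (skewLen n₁ n₂ (skewIdx i j) * X k (skewIdx i j)) := by
    rw [← hsum]
    rfl
  show ((√(skewLen n₁ n₂ (skewIdx i j)) : ℝ) : ℂ)⁻¹ *
    sampling ω (liftAdj (hankel X : Tensor3 n₁ n₂ s)) k (skewIdx i j) = _
  rw [sampling, Matrix.sum_apply, Finset.mul_sum]
  refine Finset.sum_congr rfl fun t _ => ?_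
  rw [Matrix.single_apply]
  by_cases h : (k, skewIdx i j) = ω t
  · rw [if_pos h, ← h, if_pos ⟨rfl, rfl⟩, hA, hw, hankel]
  · rw [if_neg h, if_neg, mul_zero]
    rintro ⟨h1, h2⟩
    exact h (by rw [← h1, ← h2])

theorem skewIdx_injective_right (i : Fin n₁) :
    Function.Injective (skewIdx i : Fin n₂ → Fin (n₁ + n₂ - 1)) := by
  intro j j' h
  have := congrArg Fin.val h
  simp only [skewIdx] at this
  exact Fin.ext (by omega)

theorem skewIdx_injective_left (j : Fin n₂) :
    Function.Injective fun i : Fin n₁ => skewIdx i j := by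
  intro i i' h
  have := congrArg Fin.val h
  simp only [skewIdx] at this
  exact Fin.ext (by omega)

theorem mat1_samplingError {m : ℕ} (hm : 0 < m) (hs : 0 < s) (hn : 0 < n₁ + n₂ - 1)
    (ω : Fin m → Fin s × Fin (n₁ + n₂ - 1)) {Z : Tensor3 n₁ n₂ s}
    (hZ : ∃ X : Matrix (Fin s) (Fin (n₁ + n₂ - 1)) ℂ, Z = hankel X) :
    mat1 (samplingError ω Z) =
      ((m : ℂ) / ((s : ℂ) * ((n₁ + n₂ - 1 : ℕ) : ℂ)))⁻¹ •
        (∑ t, colourPart (mat1 Z) (fun i c => (c.1, skewIdx i c.2)) (ω t) -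
          ((m : ℂ) / Fintype.card (Fin s × Fin (n₁ + n₂ - 1))) • mat1 Z) := by
  obtain ⟨X, rfl⟩ := hZ
  have hm' : (m : ℂ) ≠ 0 := Nat.cast_ne_zero.2 hm.ne'
  have hs' : (s : ℂ) ≠ 0 := Nat.cast_ne_zero.2 hs.ne'
  have hn' : ((n₁ + n₂ - 1 : ℕ) : ℂ) ≠ 0 := Nat.cast_ne_zero.2 hn.ne'
  rw [smul_sub, smul_smul, Fintype.card_prod, Fintype.card_fin, Fintype.card_fin, Nat.cast_mul,
    inv_mul_cancel₀ (div_ne_zero hm' (mul_ne_zero hs' hn')), one_smul]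
  ext i c
  simp only [mat1, samplingError, colourPart, of_apply, Pi.sub_apply, Pi.smul_apply,
    Matrix.sub_apply, Matrix.smul_apply, Matrix.sum_apply, lift_sampling_liftAdj_hankel]

theorem mat2_samplingError {m : ℕ} (hm : 0 < m) (hs : 0 < s) (hn : 0 < n₁ + n₂ - 1)
    (ω : Fin m → Fin s × Fin (n₁ + n₂ - 1)) {Z : Tensor3 n₁ n₂ s}
    (hZ : ∃ X : Matrix (Fin s) (Fin (n₁ + n₂ - 1)) ℂ, Z = hankel X) :
    mat2 (samplingError ω Z) =
      ((m : ℂ) / ((s : ℂ) * ((n₁ + n₂ - 1 : ℕ) : ℂ)))⁻¹ •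
        (∑ t, colourPart (mat2 Z) (fun j c => (c.1, skewIdx c.2 j)) (ω t) -
          ((m : ℂ) / Fintype.card (Fin s × Fin (n₁ + n₂ - 1))) • mat2 Z) := by
  obtain ⟨X, rfl⟩ := hZ
  have hm' : (m : ℂ) ≠ 0 := Nat.cast_ne_zero.2 hm.ne'
  have hs' : (s : ℂ) ≠ 0 := Nat.cast_ne_zero.2 hs.ne'
  have hn' : ((n₁ + n₂ - 1 : ℕ) : ℂ) ≠ 0 := Nat.cast_ne_zero.2 hn.ne'
  rw [smul_sub, smul_smul, Fintype.card_prod, Fintype.card_fin, Fintype.card_fin, Nat.cast_mul,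
    inv_mul_cancel₀ (div_ne_zero hm' (mul_ne_zero hs' hn')), one_smul]
  ext i c
  simp only [mat2, samplingError, colourPart, of_apply, Pi.sub_apply, Pi.smul_apply,
    Matrix.sub_apply, Matrix.smul_apply, Matrix.sum_apply, lift_sampling_liftAdj_hankel]

open scoped Matrix.Norms.L2Operator in
theorem specNorm_smul {ι κ : Type*} [Fintype ι] [Fintype κ] [DecidableEq κ] (z : ℂ)
    (A : Matrix ι κ ℂ) : specNorm (z • A) = ‖z‖ * specNorm A := norm_smul z A

end Tensor

/-! ### From probabilities to counting -/

section Probability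

open MeasureTheory ProbabilityTheory

/-- By independence the joint law is a product of uniform laws, so every sample sequence has the
same mass. Only an inclusion is asked of `G`, so its measurability is not needed. -/
theorem measureReal_forall_notMem_ge {Ω α : Type*} [MeasurableSpace Ω] (P : Measure Ω)
    [IsProbabilityMeasure P] [Fintype α] [Nonempty α] [DecidableEq α] [MeasurableSpace α]
    [MeasurableSingletonClass α] {m : ℕ} {ω : Fin m → Ω → α} (hω : ∀ t, Measurable (ω t))
    (hind : iIndepFun ω P) (hunif : ∀ t, P.map (ω t) = uniformOn Set.univ)
    (A : Finset (Fin m → α)) {G : Set Ω} (hG : ∀ x, (fun t => ω t x) ∉ A → x ∈ G) :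
    1 - (A.card : ℝ) / (Fintype.card α : ℝ) ^ m ≤ P.real G := by
  have hmeas : Measurable fun x t => ω t x := measurable_pi_lambda _ hω
  have hmap := (iIndepFun_iff_map_fun_eq_pi_map fun t => (hω t).aemeasurable).1 hind
  simp only [hunif] at hmap
  have hpre : P.real ((fun x t => ω t x) ⁻¹' (A : Set (Fin m → α))) =
      (A.card : ℝ) / (Fintype.card α : ℝ) ^ m := by
    rw [← map_measureReal_apply hmeas A.measurableSet, hmap]
    rw [← sum_measureReal_singleton]
    have : ∀ f : Fin m → α, (Measure.pi fun _ : Fin m => (uniformOn Set.univ : Measure α)).real {f} =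
        ((Fintype.card α : ℝ) ^ m)⁻¹ := by
      intro f
      rw [Measure.real, Measure.pi_singleton]
      simp [uniformOn_univ]
    simp [this, div_eq_mul_inv]
  rw [← hpre, ← probReal_compl_eq_one_sub (hmeas A.measurableSet)]
  exact measureReal_mono fun x hx => hG x fun h => hx h

end Probability

/-- The sampling error of a zero tensor vanishes. -/
theorem samplingError_zero {n₁ n₂ s m : ℕ} (ω : Fin m → Fin s × Fin (n₁ + n₂ - 1)) :
    samplingError ω (0 : Tensor3 n₁ n₂ s) = 0 := by
  have h : (0 : Tensor3 n₁ n₂ s) = hankel 0 := rfl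
  ext i j k
  simp only [samplingError, Pi.sub_apply, Pi.smul_apply]
  rw [h, lift_sampling_liftAdj_hankel]
  simp [hankel]

open scoped Matrix.Norms.L2Operator in
theorem specNorm_zero {ι κ : Type*} [Fintype ι] [Fintype κ] [DecidableEq κ] :
    specNorm (0 : Matrix ι κ ℂ) = 0 := norm_zero

end HankelTensor

/-! ### The main theorem -/

open HankelTensor in
theorem mainTheorem6 :
    ∃ C : ℝ, 0 < C ∧
      ∀ (n₁ n₂ s r m : ℕ) (_ : 0 < n₁) (_ : 0 < n₂) (_ : 0 < s) (_ : 0 < m) (μ₀ : ℝ)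
        (Z : HankelTensor.Tensor3 n₁ n₂ s) (_ : HankelTensor.IsIncoherent μ₀ r Z)
        (_ : μ₀ * HankelTensor.symConst n₁ n₂ * s * r *
          Real.log ((s : ℝ) * ((n₁ + n₂ - 1 : ℕ) : ℝ)) ≤ (m : ℝ))
        (Ω : Type*) (_ : MeasurableSpace Ω) (P : MeasureTheory.Measure Ω)
        (_ : MeasureTheory.IsProbabilityMeasure P)
        (ω : Fin m → Ω → Fin s × Fin (n₁ + n₂ - 1))
        (_ : ∀ t, Measurable (ω t))
        (_ : ProbabilityTheory.iIndepFun ω P)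
        (_ : ∀ t, P.map (ω t) = ProbabilityTheory.uniformOn Set.univ),
        1 - (((s : ℝ) * ((n₁ + n₂ - 1 : ℕ) : ℝ)) ^ 2)⁻¹ ≤
          P.real {x |
            HankelTensor.specNorm
                (HankelTensor.mat1 (HankelTensor.samplingError (fun t => ω t x) Z)) ≤
              C * Real.sqrt (μ₀ * HankelTensor.symConst n₁ n₂ * s * r *
                Real.log ((s : ℝ) * ((n₁ + n₂ - 1 : ℕ) : ℝ)) / m) * HankelTensor.sigmaMax Z ∧
            HankelTensor.specNorm
                (HankelTensor.mat2 (HankelTensor.samplingError (fun t => ω t x) Z)) ≤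
              C * Real.sqrt (μ₀ * HankelTensor.symConst n₁ n₂ * s * r *
                Real.log ((s : ℝ) * ((n₁ + n₂ - 1 : ℕ) : ℝ)) / m) * HankelTensor.sigmaMax Z} := by
  refine ⟨√(72 * Real.exp 8), by positivity, ?_⟩
  intro n₁ n₂ s r m hn₁ hn₂ hs hm μ₀ Z hZ hmB Ω _ P _ ω hω hind hunif
  have hn : 0 < n₁ + n₂ - 1 := by omega
  have : NeZero s := ⟨hs.ne'⟩
  have : NeZero (n₁ + n₂ - 1) := ⟨hn.ne'⟩
  have hcard : Fintype.card (Fin s × Fin (n₁ + n₂ - 1)) = s * (n₁ + n₂ - 1) := by simp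
  have hσ := sigmaMax_nonneg Z
  set σ : ℝ := sigmaMax Z
  obtain ⟨r1, r2, c1, c2, he⟩ := hZ.bounds rfl
  set y : ℝ := μ₀ * symConst n₁ n₂ * r / ((n₁ + n₂ - 1 : ℕ) : ℝ) with hy
  have hn' : (0 : ℝ) < ((n₁ + n₂ - 1 : ℕ) : ℝ) := Nat.cast_pos.2 hn
  have hs' : (0 : ℝ) < s := Nat.cast_pos.2 hs
  have hm' : (0 : ℝ) < m := Nat.cast_pos.2 hm
  have hN0 : (0 : ℝ) < s * ((n₁ + n₂ - 1 : ℕ) : ℝ) := by positivity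
  have hrhs : 0 ≤ √(72 * Real.exp 8) * √(μ₀ * symConst n₁ n₂ * s * r *
      Real.log (s * ((n₁ + n₂ - 1 : ℕ) : ℝ)) / m) * σ := by positivity
  -- If `y ≤ 0` the square root is zero by convention; then, or if `σ = 0`, the entry bound forces
  -- `Z = 0`.
  by_cases hdeg : √y ^ 2 * σ ≤ 0
  · have hZ0 : Z = 0 := by
      ext i j k
      exact norm_le_zero_iff.1 ((he i j k).trans hdeg)
    have hall : ∀ x, specNorm (mat1 (samplingError (fun t => ω t x) Z)) = 0 ∧
        specNorm (mat2 (samplingError (fun t => ω t x) Z)) = 0 := by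
      intro x
      rw [hZ0, samplingError_zero]
      exact ⟨specNorm_zero, specNorm_zero⟩
    rw [Set.eq_univ_of_forall (s := {x | _ ∧ _}) fun x => ⟨(hall x).1.trans_le hrhs,
      (hall x).2.trans_le hrhs⟩, MeasureTheory.probReal_univ]
    exact sub_le_self _ (by positivity)
  push Not at hdeg
  have hσ0 : 0 < σ := hσ.lt_of_ne fun h => by simp [← h] at hdeg
  have hy0 : 0 < y := by
    by_contra h
    rw [Real.sqrt_eq_zero_of_nonpos (not_lt.1 h)] at hdeg
    simp at hdeg
  rw [Real.sq_sqrt hy0.le] at *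
  -- For `N = 1` the claimed probability is at least `0`.
  by_cases hsn : s * (n₁ + n₂ - 1) ≤ 1
  · have h1 : s * (n₁ + n₂ - 1) = 1 := le_antisymm hsn (Nat.mul_pos hs hn)
    have h2 : (s : ℝ) * ((n₁ + n₂ - 1 : ℕ) : ℝ) = 1 := by exact_mod_cast h1
    rw [h2]
    simp
  have hsn2 : 2 ≤ s * (n₁ + n₂ - 1) := by omega
  have hN2 : (2 : ℝ) ≤ s * ((n₁ + n₂ - 1 : ℕ) : ℝ) := by exact_mod_cast hsn2
  have hB : μ₀ * symConst n₁ n₂ * s * r = y * (s * ((n₁ + n₂ - 1 : ℕ) : ℝ)) := by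
    rw [hy]
    field_simp
  rw [hB] at hmB ⊢
  set N : ℝ := s * ((n₁ + n₂ - 1 : ℕ) : ℝ) with hN
  have hcardN : (Fintype.card (Fin s × Fin (n₁ + n₂ - 1)) : ℝ) = N := by rw [hcard]; push_cast; rfl
  have hNsum : (Fintype.card (Fin s × Fin (n₁ + n₂ - 1)) : ℝ) * (y * N * (σ / N) ^ 2) = y * σ ^ 2 := by
    rw [hcardN]
    field_simp
  have hentry : y * N * (σ / N) = y * σ := by field_simp
  -- `B` and `τ` solve `B τ = y σ` and `N B τ² = y σ²`, the entry bound and the row and column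
  -- bounds.
  have k1 := card_colour_sampling_le (m := m) (M := mat1 Z)
    (φ := fun i c => ((c.1, skewIdx i c.2) : Fin s × Fin (n₁ + n₂ - 1)))
    (fun i c c' h => Prod.ext (Prod.ext_iff.1 h).1 (skewIdx_injective_right i (Prod.ext_iff.1 h).2))
    (fun c i i' h => skewIdx_injective_left c.2 (Prod.ext_iff.1 h).2)
    (B := y * N) (τ := σ / N) (by positivity) (by positivity)
    (fun i c => (he i c.2 c.1).trans_eq hentry.symm) (fun i => (r1 i).trans_eq hNsum.symm)
    (fun c => (c1 c).trans_eq hNsum.symm) (hsn2.trans_eq hcard.symm) hm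
    (by rw [hcardN]; exact hmB)
  have k2 := card_colour_sampling_le (m := m) (M := mat2 Z)
    (φ := fun j c => ((c.1, skewIdx c.2 j) : Fin s × Fin (n₁ + n₂ - 1)))
    (fun j c c' h => Prod.ext (Prod.ext_iff.1 h).1 (skewIdx_injective_left j (Prod.ext_iff.1 h).2))
    (fun c j j' h => skewIdx_injective_right c.2 (Prod.ext_iff.1 h).2)
    (B := y * N) (τ := σ / N) (by positivity) (by positivity)
    (fun j c => (he c.2 j c.1).trans_eq hentry.symm) (fun j => (r2 j).trans_eq hNsum.symm)
    (fun c => (c2 c).trans_eq hNsum.symm) (hsn2.trans_eq hcard.symm) hm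
    (by rw [hcardN]; exact hmB)
  have hscale : ‖((m : ℂ) / ((s : ℂ) * ((n₁ + n₂ - 1 : ℕ) : ℂ)))⁻¹‖ = N / m := by
    rw [norm_inv, norm_div, norm_mul, Complex.norm_natCast, Complex.norm_natCast,
      Complex.norm_natCast, inv_div]
  have hfin : ∀ e : ℝ, e ≤ √(72 * Real.exp 8) * √(y * N * Real.log N / m) * (m * (σ / N)) →
      N / m * e ≤ √(72 * Real.exp 8) * √(y * N * Real.log N / m) * σ := by
    intro e h
    calc N / m * e ≤ N / m * (√(72 * Real.exp 8) * √(y * N * Real.log N / m) * (m * (σ / N))) := by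
          gcongr
      _ = _ := by field_simp
  rw [hcardN] at k1 k2
  set A₁ := Finset.univ.filter fun f : Fin m → Fin s × Fin (n₁ + n₂ - 1) =>
      √(72 * Real.exp 8) * √(y * N * Real.log N / m) * (m * (σ / N)) <
        specNorm (∑ t, colourPart (mat1 Z) (fun i c => (c.1, skewIdx i c.2)) (f t) -
          ((m : ℂ) / Fintype.card (Fin s × Fin (n₁ + n₂ - 1))) • mat1 Z) with hA₁
  set A₂ := Finset.univ.filter fun f : Fin m → Fin s × Fin (n₁ + n₂ - 1) =>
      √(72 * Real.exp 8) * √(y * N * Real.log N / m) * (m * (σ / N)) <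
        specNorm (∑ t, colourPart (mat2 Z) (fun j c => (c.1, skewIdx c.2 j)) (f t) -
          ((m : ℂ) / Fintype.card (Fin s × Fin (n₁ + n₂ - 1))) • mat2 Z) with hA₂
  refine le_trans ?_ (measureReal_forall_notMem_ge P hω hind hunif (A₁ ∪ A₂) fun x hx => ?_)
  · have hd : ∀ a b : ℕ, 0 < b → a ≤ (n₁ + n₂ - 1) → b ≤ (n₁ + n₂ - 1) →
        (Fintype.card (Fin a) + Fintype.card (Fin s × Fin b) : ℝ) ≤ 2 * N := by
      intro a b _ ha hb
      simp only [Fintype.card_fin, Fintype.card_prod]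
      have h1 : a + s * b ≤ 2 * (s * (n₁ + n₂ - 1)) := by nlinarith
      rw [hN]
      exact_mod_cast h1
    have hunion : ((A₁ ∪ A₂).card : ℝ) ≤ A₁.card + A₂.card := by
      exact_mod_cast Finset.card_union_le _ _
    have hd1 := hd n₁ n₂ hn₂ (by omega) (by omega)
    have hd2 := hd n₂ n₁ hn₁ (by omega) (by omega)
    rw [hcardN]
    refine sub_le_sub_left ?_ _
    rw [div_le_iff₀ (by positivity)]
    -- Each dilation has size at most `2N`, so the failure probability is at most `4 N ^ (-4)`, and
    -- `4 ≤ N ^ 2`.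
    calc ((A₁ ∪ A₂).card : ℝ) ≤ 2 * N * N ^ m * (N ^ 5)⁻¹ + 2 * N * N ^ m * (N ^ 5)⁻¹ := by
          refine hunion.trans (add_le_add (k1.trans ?_) (k2.trans ?_)) <;> gcongr
      _ = 2 ^ 2 * (N ^ 4)⁻¹ * N ^ m := by field_simp; ring
      _ ≤ N ^ 2 * (N ^ 4)⁻¹ * N ^ m := by gcongr
      _ = (N ^ 2)⁻¹ * N ^ m := by field_simp
  · simp only [Finset.mem_union, hA₁, hA₂, Finset.mem_filter, Finset.mem_univ, true_and, not_or,
      not_lt] at hx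
    refine ⟨?_, ?_⟩
    · rw [mat1_samplingError hm hs hn _ hZ.1, specNorm_smul, hscale]
      exact hfin _ hx.1
    · rw [mat2_samplingError hm hs hn _ hZ.1, specNorm_smul, hscale]
      exact hfin _ hx.2
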